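/- Let $q:[0,\infty)\to\mathbb R$ satisfy $\int_0^\infty (1+x)|q(x)|\,dx<\infty$, let $a>0$, $0<\alpha\neq 1$, and let $\rho(x)=\alpha^2$ for $0\le x<a$ and $\rho(x)=1$ for $x>a$. Let $\alpha_j,\beta_j$ ($j=0,1,2$) be real numbers with $$\alpha_0\beta_1-\alpha_1\beta_0\le 0,\qquad \alpha_0\beta_2-\alpha_2\beta_0\le 0,\qquad \alpha_1\beta_2-\alpha_2\beta_1\ge 0,$$ and put $A(\lambda)=\alpha_0+i\alpha_1\lambda+\alpha_2\lambda^2$, $B(\lambda)=\beta_0+i\beta_1\lambda+\beta_2\lambda^2$. Assume that the boundary condition $B(\lambda)y'(0)+A(\lambda)y(0)=0$ is not void off the imaginary axis, that is, there is no $\lambda$ with $\operatorname{Im}\lambda>0$, $\operatorname{Re}\lambda\ne0$ and $A(\lambda)=B(\lambda)=0$. For $\operatorname{Im}\lambda\ge0$ let $e(x,\lambda)$ be the Jost solution of $$-y''+q(x)y=\lambda^2\rho(x)y,\qquad 0\le x<\infty,$$ i.e. the solution with $e(x,\lambda)=e^{i\lambda x}(1+o(1))$ and $e'(x,\lambda)=e^{i\lambda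 x}(i\lambda+o(1))$ as $x\to+\infty$, and set $$E(\lambda)=B(\lambda)\,e'(0,\lambda)+A(\lambda)\,e(0,\lambda).$$ Then $E$ has only finitely many zeros in the open upper half-plane $\operatorname{Im}\lambda>0$, and all of these zeros lie on the imaginary axis. -/

import Mathlib

open Set Filter Topology MeasureTheory

noncomputable section

namespace SturmLiouville

/-- The piecewise constant density: `α²` on `[0, a)` and `1` beyond `a`. -/
def rho (α a : ℝ) (x : ℝ) : ℝ := if x < a then α ^ 2 else 1

/-- The (one-sided at `0`) derivative on the half line `[0, ∞)`. -/
def halfDeriv (y : ℝ → ℂ) (x : ℝ) : ℂ := derivWithin y (Ici 0) x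

/-- `y` solves `-y'' + q y = l² ρ y` on `[0, ∞)` in the usual (Carathéodory) sense for a locally
integrable potential: `y` is differentiable, `y'` is absolutely continuous, and
`y'' = (q - l² ρ) y` almost everywhere. The last two are written as the integrated equation. -/
structure IsSolution (q : ℝ → ℝ) (α a : ℝ) (l : ℂ) (y : ℝ → ℂ) : Prop where
  differentiableOn : DifferentiableOn ℝ y (Ici 0)
  integrated_eq : ∀ x : ℝ, 0 ≤ x →
    halfDeriv y x = halfDeriv y 0 + ∫ t in (0 : ℝ)..x, ((q t : ℂ) - l ^ 2 * (rho α a t : ℂ)) * y t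

/-- The Jost solution at `l`: the solution with `y(x) = e^{ilx} (1 + o(1))` and
`y'(x) = e^{ilx} (il + o(1))` as `x → +∞`. -/
structure IsJostSolution (q : ℝ → ℝ) (α a : ℝ) (l : ℂ) (y : ℝ → ℂ) : Prop
    extends IsSolution q α a l y where
  tendsto_val : Tendsto (fun x : ℝ => y x * Complex.exp (-(Complex.I * l * x))) atTop (𝓝 1)
  tendsto_deriv : Tendsto (fun x : ℝ => halfDeriv y x * Complex.exp (-(Complex.I * l * x)))
    atTop (𝓝 (Complex.I * l))

open Classical in
/-- The Jost solution `e(x, l)`, as a function of `l` and `x`. It is meant for `Im l ≥ 0`, where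
a Jost solution exists and is unique on `[0, ∞)` if `(1 + x) q(x)` is integrable; the default
value `0` would make every `l` a zero of `charFun` below. -/
def jost (q : ℝ → ℝ) (α a : ℝ) (l : ℂ) : ℝ → ℂ :=
  if h : ∃ y : ℝ → ℂ, IsJostSolution q α a l y then h.choose else 0

/-- The coefficient `c₀ + i c₁ l + c₂ l²` in the boundary condition. -/
def bdryCoeff (c : Fin 3 → ℝ) (l : ℂ) : ℂ :=
  (c 0 : ℂ) + Complex.I * (c 1 : ℂ) * l + (c 2 : ℂ) * l ^ 2

/-- `E(l) = (β₀ + iβ₁l + β₂l²) e'(0, l) + (α₀ + iα₁l + α₂l²) e(0, l)`, with `A = (α₀, α₁, α₂)`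
and `B = (β₀, β₁, β₂)`. -/
def charFun (q : ℝ → ℝ) (α a : ℝ) (A B : Fin 3 → ℝ) (l : ℂ) : ℂ :=
  bdryCoeff B l * halfDeriv (jost q α a l) 0 + bdryCoeff A l * jost q α a l 0

end SturmLiouville

end

/-! Everything rests on the Wronskian identity: for Jost solutions y, z at l, m in the upper
half-plane, y'(0)z(0) - y(0)z'(0) = (l² - m²) ∫ ρ y z, because q cancels and the Wronskian decays at
infinity (`IsJostSolution.wronskian_zero`).

With z the conjugate of y, a Jost solution at -l̄, it says that Im(y'(0) ȳ(0)) is Re l times a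
positive number. The sign conditions make Im(A B̄) equal to Re l times a nonnegative number. If E(l)
= 0 and Re l ≠ 0, these signs contradict each other, so zeros are purely imaginary
(`re_eq_zero_of_charFun_eq_zero`).

On the axis l = it the solutions v_t may be taken real. Let s ≠ t be two zeros at which B has the
same strict sign. If the overlap ∫ ρ v_s v_t is positive, then the identity together with the sign
conditions forces v_s(0) v_t(0) < 0 (`realJost_mul_neg_of_zeros`). Among three nonzero reals two
share a sign, so a set of parameters with positive overlaps carries only finitely many zeros; the
roots of B are treated apart (`finite_zeros_of_overlap_pos`).

It remains to cover (0, ∞) by finitely many such sets. Near 0 the overlap is dominated by its slowly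
decaying tail; near t₀ > 0 it is close to a positive diagonal value; for large t the v_t are
positive everywhere. Compactness of the middle range finishes the count (`finite_imaginary_zeros`).
The estimates come from the Volterra equation for e^{-ilx} y(x), which also gives existence of the
Jost solutions. -/

namespace SturmLiouville

/-! ### Absolutely continuous primitives on the half line -/

/-- `u` is, on the half line `[0, ∞)`, a primitive of the locally integrable function `g`. -/
structure IsPrimitive (u g : ℝ → ℂ) : Prop where
  intervalIntegrable : ∀ x : ℝ, 0 ≤ x → IntervalIntegrable g volume 0 x
  eq_add_integral : ∀ x : ℝ, 0 ≤ x → u x = u 0 + ∫ t in (0 : ℝ)..x, g t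

theorem absolutelyContinuousOnInterval_of_re_im {f : ℝ → ℂ} {a b : ℝ}
    (hre : AbsolutelyContinuousOnInterval (fun x => (f x).re) a b)
    (him : AbsolutelyContinuousOnInterval (fun x => (f x).im) a b) :
    AbsolutelyContinuousOnInterval f a b := by
  have hc : ∀ c : ℂ, AbsolutelyContinuousOnInterval (fun _ : ℝ => c) a b := fun c =>
    (contDiff_const (c := c)).contDiffOn.absolutelyContinuousOnInterval
  have h := (hre.smul (hc 1)).add (him.smul (hc Complex.I))
  have hf : f = ((fun x => (f x).re) • fun _ => (1 : ℂ)) +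
      (fun x => (f x).im) • fun _ => Complex.I := by
    funext x
    simp [Complex.re_add_im]
  rw [hf]
  exact h

theorem absolutelyContinuousOnInterval_primitive {g : ℝ → ℂ} {a b : ℝ}
    (hg : IntervalIntegrable g volume a b) :
    AbsolutelyContinuousOnInterval (fun x => ∫ t in a..x, g t) a b := by
  have hre : IntervalIntegrable (fun t => (g t).re) volume a b := ⟨hg.1.re, hg.2.re⟩
  have him : IntervalIntegrable (fun t => (g t).im) volume a b := ⟨hg.1.im, hg.2.im⟩
  have hsub : ∀ x ∈ uIcc a b, IntervalIntegrable g volume a x := fun x hx =>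
    hg.mono_set (uIcc_subset_uIcc_left hx)
  have key : ∀ x ∈ uIcc a b, (∫ t in a..x, g t).re = ∫ t in a..x, (g t).re := fun x hx =>
    (Complex.reCLM.intervalIntegral_comp_comm (hsub x hx)).symm
  have key' : ∀ x ∈ uIcc a b, (∫ t in a..x, g t).im = ∫ t in a..x, (g t).im := fun x hx =>
    (Complex.imCLM.intervalIntegral_comp_comm (hsub x hx)).symm
  have congr : ∀ {u v : ℝ → ℝ}, (∀ x ∈ uIcc a b, u x = v x) →
      AbsolutelyContinuousOnInterval v a b → AbsolutelyContinuousOnInterval u a b := by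
    intro u v huv hv
    rw [absolutelyContinuousOnInterval_iff] at hv ⊢
    intro ε hε
    obtain ⟨δ, hδ, h⟩ := hv ε hε
    refine ⟨δ, hδ, fun E hE hlt => ?_⟩
    have := h E hE hlt
    rwa [Finset.sum_congr rfl fun i hi => by rw [huv _ (hE.1 i hi).1, huv _ (hE.1 i hi).2]]
  exact absolutelyContinuousOnInterval_of_re_im
    (congr key (hre.absolutelyContinuousOnInterval_intervalIntegral (by simp)))
    (congr key' (him.absolutelyContinuousOnInterval_intervalIntegral (by simp)))

/-- The product rule for primitives, in integrated form. -/
theorem integral_mul_primitive {g h : ℝ → ℂ} {a b : ℝ} (c d : ℂ)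
    (hg : IntervalIntegrable g volume a b) (hh : IntervalIntegrable h volume a b) :
    (c + ∫ t in a..b, g t) * (d + ∫ t in a..b, h t) = c * d +
      ∫ x in a..b, (g x * (d + ∫ t in a..x, h t) + (c + ∫ t in a..x, g t) * h x) := by
  have hc : ∀ c : ℂ, AbsolutelyContinuousOnInterval (fun _ : ℝ => c) a b := fun c =>
    (contDiff_const (c := c)).contDiffOn.absolutelyContinuousOnInterval
  have hU := (hc c).add (absolutelyContinuousOnInterval_primitive hg)
  have hV := (hc d).add (absolutelyContinuousOnInterval_primitive hh)
  have hI : IntervalIntegrable (fun x => g x * (d + ∫ t in a..x, h t) +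
      (c + ∫ t in a..x, g t) * h x) volume a b :=
    (hg.mul_continuousOn hV.continuousOn).add (hh.continuousOn_mul hU.continuousOn)
  -- The product minus its candidate primitive is absolutely continuous with derivative zero almost
  -- everywhere, hence constant; its values at the two endpoints are then compared.
  have hac := (hU.smul hV).sub (absolutelyContinuousOnInterval_primitive hI)
  obtain ⟨C, hC⟩ := hac.const_of_ae_hasDerivAt_zero (by
    filter_upwards [hg.ae_hasDerivAt_integral, hh.ae_hasDerivAt_integral,
      hI.ae_hasDerivAt_integral] with x h1 h2 h3 hx
    have e1 := (h1 hx a (by simp)).const_add c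
    have e2 := (h2 hx a (by simp)).const_add d
    have e3 := (e1.mul e2).sub (h3 hx a (by simp))
    rw [sub_self] at e3
    exact e3)
  have h1 := hC a (by simp)
  have h2 := hC b (by simp)
  rw [← h1] at h2
  simp only [Pi.sub_apply, Pi.mul_apply, Pi.add_apply, smul_eq_mul,
    intervalIntegral.integral_same, add_zero, sub_zero] at h2
  linear_combination h2

namespace IsPrimitive

variable {u v g h : ℝ → ℂ}

theorem continuousOn (hu : IsPrimitive u g) : ContinuousOn u (Ici 0) := by
  intro x hx
  have hx0 : (0 : ℝ) ≤ x := hx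
  have hx1 : 0 ≤ x + 1 := by linarith
  have h1 : ContinuousOn (fun y => u 0 + ∫ t in (0 : ℝ)..y, g t) (Icc 0 (x + 1)) := by
    rw [← uIcc_of_le hx1]
    exact continuousOn_const.add (absolutelyContinuousOnInterval_primitive
      (hu.intervalIntegrable (x + 1) hx1)).continuousOn
  have h2 : ContinuousOn u (Icc 0 (x + 1)) :=
    h1.congr fun y hy => hu.eq_add_integral y hy.1
  refine (h2 x ⟨hx0, by linarith⟩).mono_of_mem_nhdsWithin ?_
  rw [← Ici_inter_Iic]
  exact inter_mem self_mem_nhdsWithin (mem_nhdsWithin_of_mem_nhds (Iic_mem_nhds (by linarith)))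

theorem mul (hu : IsPrimitive u g) (hv : IsPrimitive v h) :
    IsPrimitive (fun x => u x * v x) (fun x => g x * v x + u x * h x) where
  intervalIntegrable x hx := by
    have hs : uIcc 0 x ⊆ Ici 0 := by rw [uIcc_of_le hx]; exact Icc_subset_Ici_self
    exact ((hu.intervalIntegrable x hx).mul_continuousOn (hv.continuousOn.mono hs)).add
      ((hv.intervalIntegrable x hx).continuousOn_mul (hu.continuousOn.mono hs))
  eq_add_integral x hx := by
    have := integral_mul_primitive (u 0) (v 0) (hu.intervalIntegrable x hx)
      (hv.intervalIntegrable x hx)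
    rw [hu.eq_add_integral x hx, hv.eq_add_integral x hx, this]
    congr 1
    refine intervalIntegral.integral_congr fun t ht => ?_
    rw [uIcc_of_le hx] at ht
    rw [hu.eq_add_integral t ht.1, hv.eq_add_integral t ht.1]

theorem add (hu : IsPrimitive u g) (hv : IsPrimitive v h) :
    IsPrimitive (fun x => u x + v x) (fun x => g x + h x) where
  intervalIntegrable x hx := (hu.intervalIntegrable x hx).add (hv.intervalIntegrable x hx)
  eq_add_integral x hx := by
    rw [hu.eq_add_integral x hx, hv.eq_add_integral x hx,
      intervalIntegral.integral_add (hu.intervalIntegrable x hx) (hv.intervalIntegrable x hx)]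
    ring

theorem const_mul (c : ℂ) (hu : IsPrimitive u g) :
    IsPrimitive (fun x => c * u x) (fun x => c * g x) where
  intervalIntegrable x hx := (hu.intervalIntegrable x hx).const_mul c
  eq_add_integral x hx := by
    rw [hu.eq_add_integral x hx, intervalIntegral.integral_const_mul]
    ring

theorem sub (hu : IsPrimitive u g) (hv : IsPrimitive v h) :
    IsPrimitive (fun x => u x - v x) (fun x => g x - h x) := by
  convert hu.add (hv.const_mul (-1)) using 2 <;> ring

theorem congr_deriv (hu : IsPrimitive u g) (hgh : ∀ x, 0 ≤ x → g x = h x) : IsPrimitive u h where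
  intervalIntegrable x hx := (hu.intervalIntegrable x hx).congr (by
    intro t ht
    rw [uIoc_of_le hx] at ht
    exact hgh t ht.1.le)
  eq_add_integral x hx := by
    rw [hu.eq_add_integral x hx]
    congr 1
    refine intervalIntegral.integral_congr fun t ht => ?_
    rw [uIcc_of_le hx] at ht
    exact hgh t ht.1

theorem of_hasDerivAt (hd : ∀ x, HasDerivAt u (g x) x) (hg : Continuous g) :
    IsPrimitive u g where
  intervalIntegrable x _ := hg.intervalIntegrable 0 x
  eq_add_integral x _ := by
    rw [intervalIntegral.integral_eq_sub_of_hasDerivAt (fun t _ => hd t)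
      (hg.intervalIntegrable 0 x)]
    ring

theorem exp (c : ℂ) : IsPrimitive (fun x : ℝ => Complex.exp (c * x))
    (fun x : ℝ => c * Complex.exp (c * x)) := by
  refine of_hasDerivAt (fun x => ?_) (by fun_prop)
  have h1 : HasDerivAt (fun x : ℝ => c * (x : ℂ)) (c * 1) x :=
    (Complex.ofRealCLM.hasDerivAt (x := x)).const_mul c
  convert h1.cexp using 1
  ring

/-- A primitive is recovered from its limit at infinity. -/
theorem eq_sub_integral_Ioi (hu : IsPrimitive u g) {L : ℂ} (hL : Tendsto u atTop (𝓝 L))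
    (hg : IntegrableOn g (Ioi 0)) {x : ℝ} (hx : 0 ≤ x) :
    u x = L - ∫ t in Ioi x, g t := by
  have h1 := intervalIntegral_tendsto_integral_Ioi 0 hg tendsto_id
  have h2 : Tendsto u atTop (𝓝 (u 0 + ∫ t in Ioi 0, g t)) := by
    refine (h1.const_add (u 0)).congr' ?_
    filter_upwards [eventually_ge_atTop 0] with y hy
    exact (hu.eq_add_integral y hy).symm
  rw [tendsto_nhds_unique hL h2, hu.eq_add_integral x hx,
    ← intervalIntegral.integral_interval_add_Ioi hg (hg.mono_set (Ioi_subset_Ioi hx))]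
  ring

/-- The tail integral of an integrable function is a primitive of its negative. -/
theorem tail (hg : IntegrableOn g (Ioi 0)) :
    IsPrimitive (fun x => ∫ t in Ioi x, g t) (fun x => -g x) where
  intervalIntegrable x hx := by
    rw [intervalIntegrable_iff_integrableOn_Ioc_of_le hx]
    exact (hg.mono_set Ioc_subset_Ioi_self).neg
  eq_add_integral x hx := by
    rw [intervalIntegral.integral_neg,
      ← intervalIntegral.integral_interval_add_Ioi hg (hg.mono_set (Ioi_subset_Ioi hx))]
    ring

theorem re (hu : IsPrimitive u g) {x y : ℝ} (hx : 0 ≤ x) (hxy : x ≤ y) :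
    (u y).re = (u x).re + ∫ t in x..y, (g t).re := by
  have hi := (hu.intervalIntegrable x hx).symm.trans (hu.intervalIntegrable y (hx.trans hxy))
  have h := Complex.reCLM.intervalIntegral_comp_comm hi
  simp only [Complex.reCLM_apply] at h
  rw [h, hu.eq_add_integral y (hx.trans hxy), hu.eq_add_integral x hx,
    ← intervalIntegral.integral_add_adjacent_intervals (hu.intervalIntegrable x hx) hi]
  simp [add_assoc]

end IsPrimitive

/-! ### Tail integrals and a Gronwall inequality from infinity -/

/-- The tail integral `∫_x^∞ w`. -/
noncomputable def tail (w : ℝ → ℝ) (x : ℝ) : ℝ := ∫ t in Ioi x, w t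

theorem tail_eq_sub {w : ℝ → ℝ} (hw : Integrable w) (x : ℝ) :
    tail w x = tail w 0 - ∫ t in (0 : ℝ)..x, w t := by
  have := intervalIntegral.integral_interval_add_Ioi (hw.integrableOn (s := Ioi 0))
    (hw.integrableOn (s := Ioi x))
  simp only [tail]
  linarith

theorem continuous_tail {w : ℝ → ℝ} (hw : Integrable w) : Continuous (tail w) := by
  have : tail w = fun x => tail w 0 - ∫ t in (0 : ℝ)..x, w t := funext (tail_eq_sub hw)
  rw [this]
  exact continuous_const.sub
    (intervalIntegral.continuous_primitive (fun _ _ => hw.intervalIntegrable) 0)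

theorem tail_nonneg {w : ℝ → ℝ} (h0 : ∀ t, 0 ≤ w t) (x : ℝ) : 0 ≤ tail w x :=
  setIntegral_nonneg measurableSet_Ioi fun t _ => h0 t

theorem tail_antitone {w : ℝ → ℝ} (hw : Integrable w) (h0 : ∀ t, 0 ≤ w t) :
    Antitone (tail w) := fun _ _ hxy =>
  setIntegral_mono_set hw.integrableOn (Eventually.of_forall h0)
    (Ioi_subset_Ioi hxy).eventuallyLE

theorem tail_le_integral {w : ℝ → ℝ} (hw : Integrable w) (h0 : ∀ t, 0 ≤ w t) (x : ℝ) :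
    tail w x ≤ ∫ t, w t :=
  setIntegral_le_integral hw (Eventually.of_forall h0)

theorem integrable_mul_exp_tail {w : ℝ → ℝ} (hw : Integrable w) (h0 : ∀ t, 0 ≤ w t) :
    Integrable (fun t => w t * Real.exp (2 * tail w t)) := by
  refine hw.mul_bdd (c := Real.exp (2 * ∫ t, w t))
    (((continuous_tail hw).const_mul 2).rexp.aestronglyMeasurable) ?_
  filter_upwards with x
  rw [Real.norm_eq_abs, Real.abs_exp]
  gcongr
  exact tail_le_integral hw h0 x

/-- The integrand is minus half the derivative of exp(2 tail w). The factor 1/2 is what makes the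
Gronwall iteration and the Volterra operator contract. Only an inequality is needed, so monotonicity
suffices. -/
theorem integral_mul_exp_tail_le {w : ℝ → ℝ} (hw : Integrable w) (h0 : ∀ t, 0 ≤ w t) (x : ℝ) :
    ∫ t in Ioi x, w t * Real.exp (2 * tail w t) ≤ Real.exp (2 * tail w x) / 2 := by
  refine le_of_tendsto (intervalIntegral_tendsto_integral_Ioi x
    (integrable_mul_exp_tail hw h0).integrableOn tendsto_id) ?_
  filter_upwards [eventually_ge_atTop x] with b hb
  have hmono : MonotoneOn (fun t => -Real.exp (2 * tail w t)) (uIcc x b) := by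
    intro s _ t _ hst
    simp only [neg_le_neg_iff]
    gcongr
    exact tail_antitone hw h0 hst
  have h1 := hmono.intervalIntegral_deriv_mem_uIcc
  have hle := hmono (left_mem_uIcc) (right_mem_uIcc) hb
  rw [uIcc_of_le (by linarith)] at h1
  have h2 : ∫ t in x..b, deriv (fun t => -Real.exp (2 * tail w t)) t =
      ∫ t in x..b, 2 * (w t * Real.exp (2 * tail w t)) := by
    refine intervalIntegral.integral_congr_ae ?_
    filter_upwards [LocallyIntegrable.ae_hasDerivAt_integral hw.locallyIntegrable] with t ht _
    have h3 : HasDerivAt (tail w) (-w t) t := by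
      have : tail w = fun x => tail w 0 - ∫ t in (0 : ℝ)..x, w t := funext (tail_eq_sub hw)
      rw [this]
      exact (ht 0).const_sub _
    have h4 : HasDerivAt (fun t => -Real.exp (2 * tail w t))
        (-(Real.exp (2 * tail w t) * (2 * -w t))) t := ((h3.const_mul 2).exp).neg
    rw [h4.deriv]
    ring
  rw [h2, intervalIntegral.integral_const_mul] at h1
  have := h1.2
  have h5 := Real.exp_pos (2 * tail w b)
  simp only [id]
  linarith

/-- A Gronwall inequality on `[0, ∞)`, integrating from infinity. -/
theorem le_exp_of_le_add_integral_Ioi {w g : ℝ → ℝ} {c M : ℝ} (hw : IntegrableOn w (Ioi 0))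
    (h0 : ∀ t, 0 < t → 0 ≤ w t) (hg0 : ∀ x, 0 ≤ x → 0 ≤ g x) (hM : ∀ x, 0 ≤ x → g x ≤ M)
    (hc : 0 ≤ c) (hg : ∀ x, 0 ≤ x → g x ≤ c + ∫ t in Ioi x, w t * g t) {x : ℝ} (hx : 0 ≤ x) :
    g x ≤ 2 * c * Real.exp (2 * ∫ t in Ioi 0, w t) := by
  set W := (Ioi (0 : ℝ)).indicator w with hWdef
  have hW : Integrable W := hw.integrable_indicator measurableSet_Ioi
  have hW0 : ∀ t, 0 ≤ W t := fun t => indicator_nonneg (fun t ht => h0 t ht) t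
  have hWw : ∀ t, 0 < t → W t = w t := fun t ht => indicator_of_mem ht w
  have hM0 : 0 ≤ M := (hg0 0 le_rfl).trans (hM 0 le_rfl)
  -- Iterating the hypothesis: 2c is reproduced since c + (2c)/2 = 2c, while the a priori bound M is
  -- halved each time and disappears in the limit.
  have key : ∀ n : ℕ, ∀ x, 0 ≤ x → g x ≤ (2 * c + M * (1 / 2) ^ n) * Real.exp (2 * tail W x) := by
    intro n
    induction n with
    | zero =>
      intro x hx
      have h1 : 1 ≤ Real.exp (2 * tail W x) :=
        Real.one_le_exp (by linarith [tail_nonneg hW0 x])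
      have := hM x hx
      simp only [pow_zero, mul_one]
      nlinarith
    | succ n ih =>
      intro x hx
      have h1 : 1 ≤ Real.exp (2 * tail W x) :=
        Real.one_le_exp (by linarith [tail_nonneg hW0 x])
      set m := 2 * c + M * (1 / 2) ^ n
      have hm : 0 ≤ m := by positivity
      have h2 : ∫ t in Ioi x, w t * g t ≤ ∫ t in Ioi x, m * (W t * Real.exp (2 * tail W t)) := by
        refine integral_mono_of_nonneg ?_
          ((integrable_mul_exp_tail hW hW0).const_mul m).integrableOn ?_
        · filter_upwards [ae_restrict_mem measurableSet_Ioi] with t ht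
          have ht0 : 0 < t := hx.trans_lt ht
          exact mul_nonneg (h0 t ht0) (hg0 t ht0.le)
        · filter_upwards [ae_restrict_mem measurableSet_Ioi] with t ht
          have ht0 : 0 < t := hx.trans_lt ht
          rw [hWw t ht0]
          have := mul_le_mul_of_nonneg_left (ih t ht0.le) (h0 t ht0)
          linarith
      rw [integral_const_mul] at h2
      have h3 := mul_le_mul_of_nonneg_left (integral_mul_exp_tail_le hW hW0 x) hm
      have h4 := hg x hx
      have h5 : 2 * c + M * (1 / 2) ^ (n + 1) = c + m / 2 := by simp only [m]; ring
      rw [h5]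
      nlinarith
  have hlim : Tendsto (fun n : ℕ => (2 * c + M * (1 / 2) ^ n) * Real.exp (2 * tail W x)) atTop
      (𝓝 ((2 * c + M * 0) * Real.exp (2 * tail W x))) :=
    (((tendsto_pow_atTop_nhds_zero_of_lt_one (by norm_num) (by norm_num)).const_mul M).const_add
      (2 * c)).mul_const _
  have h6 := ge_of_tendsto' hlim fun n => key n x hx
  rw [mul_zero, add_zero] at h6
  refine h6.trans ?_
  gcongr
  have h7 := tail_le_integral hW hW0 x
  rwa [hWdef, integral_indicator measurableSet_Ioi] at h7

/-! ### The density and the perturbed potential -/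

theorem integrableOn_of_one_add_mul {g : ℝ → ℝ}
    (h : IntegrableOn (fun x => (1 + x) * g x) (Ioi 0)) : IntegrableOn g (Ioi 0) := by
  have hm : AEStronglyMeasurable (fun x : ℝ => (1 + x)⁻¹) (volume.restrict (Ioi 0)) :=
    (measurable_const.add measurable_id).inv.aestronglyMeasurable
  have h1 : IntegrableOn (fun x => (1 + x)⁻¹ * ((1 + x) * g x)) (Ioi 0) := by
    refine Integrable.bdd_mul (c := 1) h hm ?_
    filter_upwards [ae_restrict_mem measurableSet_Ioi] with x hx
    have hx0 : (0 : ℝ) < x := hx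
    rw [norm_inv, Real.norm_of_nonneg (by linarith)]
    exact inv_le_one_of_one_le₀ (by linarith)
  refine h1.congr_fun (fun x hx => ?_) measurableSet_Ioi
  have hx0 : (0 : ℝ) < x := hx
  simp only
  field_simp

theorem integrableOn_id_mul_of_one_add_mul {g : ℝ → ℝ}
    (h : IntegrableOn (fun x => (1 + x) * g x) (Ioi 0)) :
    IntegrableOn (fun x => x * g x) (Ioi 0) := by
  refine (h.sub (integrableOn_of_one_add_mul h)).congr_fun (fun x _ => ?_) measurableSet_Ioi
  simp only [Pi.sub_apply]
  ring

theorem measurable_rho (α a : ℝ) : Measurable (rho α a) :=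
  Measurable.ite measurableSet_Iio measurable_const measurable_const

theorem rho_pos {α : ℝ} (hα : 0 < α) (a x : ℝ) : 0 < rho α a x := by
  unfold rho
  split_ifs <;> positivity

theorem rho_le (α a x : ℝ) : rho α a x ≤ α ^ 2 + 1 := by
  unfold rho
  split_ifs <;> nlinarith [sq_nonneg α]

theorem min_le_rho (α a x : ℝ) : min (α ^ 2) 1 ≤ rho α a x := by
  unfold rho
  split_ifs
  · exact min_le_left _ _
  · exact min_le_right _ _

/-- Since 1 - ρ vanishes beyond a, the term l²(1 - ρ) can be counted as part of the potential. -/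
theorem integrableOn_one_add_mul_one_sub_rho (α a : ℝ) :
    IntegrableOn (fun x => (1 + x) * (1 - rho α a x)) (Ioi 0) := by
  have h : (fun x => (1 + x) * (1 - rho α a x)) =
      (Iio a).indicator (fun x => (1 + x) * (1 - α ^ 2)) := by
    funext x
    by_cases hx : x < a
    · simp [rho, hx]
    · simp [rho, hx]
  rw [h, IntegrableOn, integrable_indicator_iff measurableSet_Iio, IntegrableOn,
    Measure.restrict_restrict measurableSet_Iio]
  have : Continuous fun x : ℝ => (1 + x) * (1 - α ^ 2) := by fun_prop
  exact (this.integrableOn_Icc (a := 0) (b := a)).mono_set fun x hx => ⟨le_of_lt hx.2, le_of_lt hx.1⟩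

/-- The perturbation `q + l² (1 - ρ)`, so that the equation reads `y'' = (pert - l²) y`. -/
noncomputable def pert (q : ℝ → ℝ) (α a : ℝ) (l : ℂ) (x : ℝ) : ℂ :=
  (q x : ℂ) + l ^ 2 * ((1 - rho α a x : ℝ) : ℂ)

/-- The kernel `(e^{2ilu} - 1) / (2il)` of the Volterra equation for the Jost solution. -/
noncomputable def jostKernel (l : ℂ) (u : ℝ) : ℂ :=
  (Complex.exp (2 * Complex.I * l * u) - 1) / (2 * Complex.I * l)

/-- The exponential has modulus at most 1. For fixed l this bound makes plain integrability of q
sufficient; the weight 1 + x serves only for uniformity as l → 0. -/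
theorem norm_jostKernel_le {l : ℂ} (hl : 0 < l.im) {u : ℝ} (hu : 0 ≤ u) :
    ‖jostKernel l u‖ ≤ 1 / ‖l‖ := by
  have hl0 : 0 < ‖l‖ := norm_pos_iff.2 (by rintro rfl; simp at hl)
  have h1 : ‖Complex.exp (2 * Complex.I * l * u)‖ ≤ 1 := by
    rw [Complex.norm_exp]
    refine Real.exp_le_one_iff.2 ?_
    simp
    positivity
  have h2 : ‖Complex.exp (2 * Complex.I * l * u) - 1‖ ≤ 2 := by
    refine (norm_sub_le _ _).trans ?_
    rw [norm_one]
    linarith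
  rw [jostKernel, norm_div]
  simp only [norm_mul, Complex.norm_I, Complex.norm_ofNat, mul_one]
  rw [div_le_div_iff₀ (by positivity) hl0]
  nlinarith

/-! ### Solutions, the Wronskian identity and the Volterra equation -/

section

variable {q : ℝ → ℝ} {α a : ℝ} {l : ℂ} {y : ℝ → ℂ}

theorem integrableOn_Ioi_of_Ici (hq : IntegrableOn (fun x : ℝ => (1 + x) * q x) (Ici 0)) :
    IntegrableOn (fun x : ℝ => (1 + x) * q x) (Ioi 0) := hq.mono_set Ioi_subset_Ici_self

theorem integrableOn_pert (hq : IntegrableOn (fun x : ℝ => (1 + x) * q x) (Ici 0)) :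
    IntegrableOn (pert q α a l) (Ioi 0) :=
  (integrableOn_of_one_add_mul (integrableOn_Ioi_of_Ici hq)).ofReal.add
    ((integrableOn_of_one_add_mul (integrableOn_one_add_mul_one_sub_rho α a)).ofReal.const_mul
      (l ^ 2))

theorem intervalIntegrable_coeff (hq : IntegrableOn (fun x : ℝ => (1 + x) * q x) (Ici 0))
    {x : ℝ} (hx : 0 ≤ x) :
    IntervalIntegrable (fun t => (q t : ℂ) - l ^ 2 * (rho α a t : ℂ)) volume 0 x := by
  have h1 : IntervalIntegrable (pert q α a l) volume 0 x := by
    rw [intervalIntegrable_iff_integrableOn_Ioc_of_le hx]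
    exact (integrableOn_pert hq).mono_set Ioc_subset_Ioi_self
  refine (h1.sub (intervalIntegrable_const (c := l ^ 2))).congr fun t _ => ?_
  simp only [pert]
  push_cast
  ring

namespace IsSolution

theorem continuousOn (hy : IsSolution q α a l y) : ContinuousOn y (Ici 0) :=
  hy.differentiableOn.continuousOn

theorem isPrimitive_halfDeriv (hq : IntegrableOn (fun x : ℝ => (1 + x) * q x) (Ici 0))
    (hy : IsSolution q α a l y) :
    IsPrimitive (halfDeriv y) (fun t => ((q t : ℂ) - l ^ 2 * (rho α a t : ℂ)) * y t) where
  intervalIntegrable x hx := by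
    refine (intervalIntegrable_coeff hq hx).mul_continuousOn (hy.continuousOn.mono ?_)
    rw [uIcc_of_le hx]
    exact Icc_subset_Ici_self
  eq_add_integral := hy.integrated_eq

theorem isPrimitive (hq : IntegrableOn (fun x : ℝ => (1 + x) * q x) (Ici 0))
    (hy : IsSolution q α a l y) : IsPrimitive y (halfDeriv y) := by
  have hc := (hy.isPrimitive_halfDeriv hq).continuousOn
  have hi : ∀ x : ℝ, 0 ≤ x → IntervalIntegrable (halfDeriv y) volume 0 x := fun x hx => by
    refine (hc.mono ?_).intervalIntegrable
    rw [uIcc_of_le hx]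
    exact Icc_subset_Ici_self
  refine ⟨hi, fun x hx => ?_⟩
  rw [intervalIntegral.integral_eq_sub_of_hasDerivAt_of_le hx
    (hy.continuousOn.mono Icc_subset_Ici_self) (fun t ht => ?_) (hi x hx)]
  · ring
  · exact (hy.differentiableOn t ht.1.le).hasDerivWithinAt.hasDerivAt (Ici_mem_nhds ht.1)

end IsSolution

theorem exists_norm_le_of_tendsto {f : ℝ → ℂ} {L : ℂ} (hf : ContinuousOn f (Ici 0))
    (hL : Tendsto f atTop (𝓝 L)) : ∃ C : ℝ, 0 ≤ C ∧ ∀ x, 0 ≤ x → ‖f x‖ ≤ C := by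
  obtain ⟨X, hX⟩ := eventually_atTop.1
    (hL.norm.eventually_lt_const (lt_add_one ‖L‖))
  obtain ⟨C, hC⟩ := (isCompact_Icc (a := (0 : ℝ)) (b := X)).exists_bound_of_continuousOn
    (hf.mono Icc_subset_Ici_self)
  refine ⟨max C (‖L‖ + 1), le_max_of_le_right (by positivity), fun x hx => ?_⟩
  rcases le_total x X with h | h
  · exact (hC x ⟨hx, h⟩).trans (le_max_left _ _)
  · exact (hX x h).le.trans (le_max_right _ _)

theorem tendsto_exp_mul_atTop {l : ℂ} (hl : 0 < l.im) :
    Tendsto (fun x : ℝ => Complex.exp (Complex.I * l * x)) atTop (𝓝 0) := by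
  rw [tendsto_zero_iff_norm_tendsto_zero]
  have h : ∀ x : ℝ, ‖Complex.exp (Complex.I * l * x)‖ = Real.exp (-(l.im * x)) := fun x => by
    rw [Complex.norm_exp]
    simp
  simp_rw [h]
  exact Real.tendsto_exp_neg_atTop_nhds_zero.comp (tendsto_id.const_mul_atTop hl)

theorem continuousOn_mul_exp {f : ℝ → ℂ} (hf : ContinuousOn f (Ici 0)) (c : ℂ) :
    ContinuousOn (fun x : ℝ => f x * Complex.exp (-(c * x))) (Ici 0) :=
  hf.mul (Continuous.continuousOn (by fun_prop))

namespace IsJostSolution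

theorem exists_norm_le (hy : IsJostSolution q α a l y) :
    ∃ C : ℝ, 0 ≤ C ∧ ∀ x, 0 ≤ x → ‖y x * Complex.exp (-(Complex.I * l * x))‖ ≤ C :=
  exists_norm_le_of_tendsto (continuousOn_mul_exp hy.toIsSolution.continuousOn _) hy.tendsto_val

theorem integrableOn_rho_mul {m : ℂ} {z : ℝ → ℂ} (hy : IsJostSolution q α a l y)
    (hz : IsJostSolution q α a m z) (hl : 0 < l.im) (hm : 0 < m.im) :
    IntegrableOn (fun x => (rho α a x : ℂ) * (y x * z x)) (Ioi 0) := by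
  obtain ⟨C, hC0, hC⟩ := hy.exists_norm_le
  obtain ⟨D, hD0, hD⟩ := hz.exists_norm_le
  have hexp : IntegrableOn (fun x : ℝ => Real.exp (-(l.im + m.im) * x)) (Ioi 0) :=
    exp_neg_integrableOn_Ioi 0 (by linarith)
  refine Integrable.mono' (hexp.const_mul ((α ^ 2 + 1) * (C * D))) ?_ ?_
  · refine ((Complex.measurable_ofReal.comp (measurable_rho α a)).aestronglyMeasurable).mul ?_
    exact ((hy.toIsSolution.continuousOn.mul hz.toIsSolution.continuousOn).mono
      Ioi_subset_Ici_self).aestronglyMeasurable measurableSet_Ioi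
  · filter_upwards [ae_restrict_mem measurableSet_Ioi] with x hx
    have hx0 : (0 : ℝ) ≤ x := le_of_lt hx
    have h1 := hC x hx0
    have h2 := hD x hx0
    rw [norm_mul, Complex.norm_exp] at h1 h2
    simp only [Complex.neg_re, Complex.mul_re, Complex.I_re, Complex.I_im, zero_mul, one_mul,
      zero_sub, Complex.ofReal_re, Complex.mul_im, Complex.ofReal_im, mul_zero, sub_zero,
      neg_mul, neg_neg] at h1 h2
    have h3 : ‖y x‖ ≤ C * Real.exp (-(l.im * x)) := by
      rw [Real.exp_neg]
      exact (le_mul_inv_iff₀ (Real.exp_pos _)).2 h1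
    have h4 : ‖z x‖ ≤ D * Real.exp (-(m.im * x)) := by
      rw [Real.exp_neg]
      exact (le_mul_inv_iff₀ (Real.exp_pos _)).2 h2
    have h5 : ‖(rho α a x : ℂ)‖ ≤ α ^ 2 + 1 := by
      rw [Complex.norm_real, Real.norm_of_nonneg]
      · exact rho_le α a x
      · unfold rho
        split_ifs <;> positivity
    calc ‖(rho α a x : ℂ) * (y x * z x)‖ = ‖(rho α a x : ℂ)‖ * (‖y x‖ * ‖z x‖) := by
          rw [norm_mul, norm_mul]
      _ ≤ (α ^ 2 + 1) * ((C * Real.exp (-(l.im * x))) * (D * Real.exp (-(m.im * x)))) := by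
          gcongr
      _ = (α ^ 2 + 1) * (C * D) * Real.exp (-(l.im + m.im) * x) := by
          rw [show -(l.im + m.im) * x = -(l.im * x) + -(m.im * x) by ring, Real.exp_add]
          ring

/-- The Wronskian of two Jost solutions at `0`. -/
theorem wronskian_zero {m : ℂ} {z : ℝ → ℂ}
    (hq : IntegrableOn (fun x : ℝ => (1 + x) * q x) (Ici 0))
    (hy : IsJostSolution q α a l y) (hz : IsJostSolution q α a m z)
    (hl : 0 < l.im) (hm : 0 < m.im) :
    halfDeriv y 0 * z 0 - y 0 * halfDeriv z 0 =
      (l ^ 2 - m ^ 2) * ∫ x in Ioi 0, (rho α a x : ℂ) * (y x * z x) := by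
  have py := hy.toIsSolution.isPrimitive hq
  have py' := hy.toIsSolution.isPrimitive_halfDeriv hq
  have pz := hz.toIsSolution.isPrimitive hq
  have pz' := hz.toIsSolution.isPrimitive_halfDeriv hq
  -- The potential q is common to both equations and drops out of (y'z - yz')'.
  have hW := ((py'.mul pz).sub (py.mul pz')).congr_deriv
    (h := fun x => (m ^ 2 - l ^ 2) * ((rho α a x : ℂ) * (y x * z x))) (fun x _ => by ring)
  have hlim : Tendsto (fun x => halfDeriv y x * z x - y x * halfDeriv z x) atTop (𝓝 0) := by
    have h0 : Tendsto (fun x : ℝ => Complex.exp (Complex.I * (l + m) * x)) atTop (𝓝 0) :=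
      tendsto_exp_mul_atTop (by simpa using add_pos hl hm)
    have h1 := ((hy.tendsto_deriv.mul hz.tendsto_val).sub
      (hy.tendsto_val.mul hz.tendsto_deriv)).mul h0
    rw [mul_zero] at h1
    refine h1.congr fun x => ?_
    have e : Complex.exp (-(Complex.I * l * x)) * Complex.exp (-(Complex.I * m * x)) *
        Complex.exp (Complex.I * (l + m) * x) = 1 := by
      rw [← Complex.exp_add, ← Complex.exp_add, Complex.exp_eq_one_iff]
      exact ⟨0, by push_cast; ring⟩
    linear_combination (halfDeriv y x * z x - y x * halfDeriv z x) * e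
  have h := hW.eq_sub_integral_Ioi hlim
    ((hy.integrableOn_rho_mul hz hl hm).const_mul _) le_rfl
  rw [integral_const_mul] at h
  rw [h]
  ring

theorem integrableOn_pert_mul (hq : IntegrableOn (fun x : ℝ => (1 + x) * q x) (Ici 0))
    (hy : IsJostSolution q α a l y) :
    IntegrableOn (fun x => pert q α a l x * (y x * Complex.exp (-(Complex.I * l * x))))
      (Ioi 0) := by
  obtain ⟨C, hC0, hC⟩ := hy.exists_norm_le
  refine Integrable.mul_bdd (c := C) (integrableOn_pert hq) ?_ ?_
  · exact ((continuousOn_mul_exp hy.toIsSolution.continuousOn _).mono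
      Ioi_subset_Ici_self).aestronglyMeasurable measurableSet_Ioi
  · filter_upwards [ae_restrict_mem measurableSet_Ioi] with x hx
    exact hC x (le_of_lt hx)

end IsJostSolution

theorem integrableOn_exp_mul {g : ℝ → ℂ} (hl : 0 < l.im) (hg : IntegrableOn g (Ioi 0)) :
    IntegrableOn (fun x : ℝ => Complex.exp (2 * Complex.I * l * x) * g x) (Ioi 0) := by
  refine Integrable.bdd_mul (c := 1) hg (Continuous.aestronglyMeasurable (by fun_prop)) ?_
  filter_upwards [ae_restrict_mem measurableSet_Ioi] with x hx
  have hx0 : (0 : ℝ) < x := hx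
  rw [Complex.norm_exp]
  refine Real.exp_le_one_iff.2 ?_
  simp
  positivity

/-- The Volterra integral in terms of the two fundamental exponentials. -/
theorem integral_jostKernel_mul {g : ℝ → ℂ} (hl : 0 < l.im) (hg : IntegrableOn g (Ioi 0))
    {x : ℝ} (hx : 0 ≤ x) :
    ∫ t in Ioi x, jostKernel l (t - x) * g t =
      (Complex.exp (-(2 * Complex.I * l * x)) *
        (∫ t in Ioi x, Complex.exp (2 * Complex.I * l * t) * g t) - ∫ t in Ioi x, g t) /
        (2 * Complex.I * l) := by
  have h1 := (integrableOn_exp_mul hl hg).mono_set (Ioi_subset_Ioi hx)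
  have h2 := hg.mono_set (Ioi_subset_Ioi hx)
  rw [← integral_const_mul, ← integral_sub (h1.const_mul _) h2, ← integral_div]
  refine integral_congr_ae (Eventually.of_forall fun t => ?_)
  simp only [jostKernel]
  have e : Complex.exp (2 * Complex.I * l * ((t - x : ℝ) : ℂ)) =
      Complex.exp (-(2 * Complex.I * l * x)) * Complex.exp (2 * Complex.I * l * t) := by
    rw [← Complex.exp_add]
    congr 1
    push_cast
    ring
  rw [e]
  ring

/-- The Volterra equation satisfied by `e^{-ilx} y(x)` for a Jost solution `y`. -/
theorem IsJostSolution.volterra (hq : IntegrableOn (fun x : ℝ => (1 + x) * q x) (Ici 0))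
    (hy : IsJostSolution q α a l y) (hl : 0 < l.im) {x : ℝ} (hx : 0 ≤ x) :
    y x * Complex.exp (-(Complex.I * l * x)) = 1 + ∫ t in Ioi x, jostKernel l (t - x) *
      (pert q α a l t * (y t * Complex.exp (-(Complex.I * l * t)))) := by
  have hl0 : l ≠ 0 := by rintro rfl; simp at hl
  have hc : 2 * Complex.I * l ≠ 0 := by simp [hl0]
  have hI : Complex.I ^ 2 = -1 := Complex.I_sq
  have py := hy.toIsSolution.isPrimitive hq
  have py' := hy.toIsSolution.isPrimitive_halfDeriv hq
  have hg := hy.integrableOn_pert_mul hq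
  set g : ℝ → ℂ := fun t => pert q α a l t * (y t * Complex.exp (-(Complex.I * l * t))) with hgdef
  -- Variation of constants: e^{-ilx}(y' + ily) and e^{ilx}(ily - y') have derivatives g and
  -- -e^{2ilx}g and limits 2il and 0. Recovering both from infinity and eliminating y' gives the
  -- Volterra equation.
  have hP := ((IsPrimitive.exp (-(Complex.I * l))).mul
    (py'.add (py.const_mul (Complex.I * l)))).congr_deriv (h := g) (fun t _ => by
      simp only [hgdef, pert, neg_mul]
      push_cast
      linear_combination -(l ^ 2) * y t * Complex.exp (-(Complex.I * l * t)) * hI)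
  have hR := ((IsPrimitive.exp (Complex.I * l)).mul
    ((py.const_mul (Complex.I * l)).sub py')).congr_deriv
      (h := fun t => (-1) * (Complex.exp (2 * Complex.I * l * t) * g t)) (fun t _ => by
      have e : Complex.exp (2 * Complex.I * l * t) * Complex.exp (-(Complex.I * l * t)) =
          Complex.exp (Complex.I * l * t) := by
        rw [← Complex.exp_add]
        congr 1
        ring
      simp only [hgdef, pert]
      push_cast
      linear_combination (l ^ 2) * y t * Complex.exp (Complex.I * l * t) * hI +
        ((q t : ℂ) + l ^ 2 * (1 - rho α a t)) * y t * e)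
  have limP : Tendsto (fun x : ℝ => Complex.exp (-(Complex.I * l) * x) *
      (halfDeriv y x + Complex.I * l * y x)) atTop (𝓝 (2 * Complex.I * l)) := by
    have h := hy.tendsto_deriv.add (hy.tendsto_val.const_mul (Complex.I * l))
    rw [show Complex.I * l + Complex.I * l * 1 = 2 * Complex.I * l by ring] at h
    refine h.congr fun x => ?_
    rw [neg_mul]
    ring
  have limR : Tendsto (fun x : ℝ => Complex.exp (Complex.I * l * x) *
      (Complex.I * l * y x - halfDeriv y x)) atTop (𝓝 0) := by
    have h0 := (tendsto_exp_mul_atTop hl).mul (tendsto_exp_mul_atTop hl)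
    have h := h0.mul ((hy.tendsto_val.const_mul (Complex.I * l)).sub hy.tendsto_deriv)
    rw [zero_mul, zero_mul] at h
    refine h.congr fun x => ?_
    have e : Complex.exp (Complex.I * l * x) * Complex.exp (-(Complex.I * l * x)) = 1 := by
      rw [← Complex.exp_add]
      simp
    linear_combination Complex.exp (Complex.I * l * x) *
      (Complex.I * l * y x - halfDeriv y x) * e
  have eP := hP.eq_sub_integral_Ioi limP hg hx
  have eR := hR.eq_sub_integral_Ioi limR ((integrableOn_exp_mul hl hg).const_mul _) hx
  rw [integral_const_mul] at eR
  rw [integral_jostKernel_mul hl hg hx]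
  have e1 : Complex.exp (-(2 * Complex.I * l * x)) * Complex.exp (Complex.I * l * x) =
      Complex.exp (-(Complex.I * l * x)) := by
    rw [← Complex.exp_add]
    congr 1
    ring
  rw [neg_mul] at eP
  rw [← sub_eq_iff_eq_add', eq_div_iff hc]
  linear_combination eP + Complex.exp (-(2 * Complex.I * l * x)) * eR -
    (Complex.I * l * y x - halfDeriv y x) * e1

end

/-! ### Existence of the Jost solution -/

theorem continuous_jostKernel (l : ℂ) : Continuous (jostKernel l) := by
  unfold jostKernel
  fun_prop

theorem jostKernel_zero (l : ℂ) : jostKernel l 0 = 0 := by simp [jostKernel]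

section Volterra

variable {p : ℝ → ℂ} {l : ℂ}

/-- The Volterra operator `g ↦ ∫_x^∞ K(t - x) p(t) g(t) dt`. -/
noncomputable def volterraOp (p : ℝ → ℂ) (l : ℂ) (g : ℝ → ℂ) (x : ℝ) : ℂ :=
  ∫ t in Ioi x, jostKernel l (t - x) * (p t * g t)

/-- As the kernel vanishes at 0, it may be truncated by max(t - x, 0). The domain no longer depends
on x and the integrand is continuous in x, so dominated convergence applies. -/
theorem volterraOp_eq (g : ℝ → ℂ) (x : ℝ) :
    volterraOp p l g x = ∫ t, jostKernel l (max (t - x) 0) * (p t * g t) := by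
  rw [volterraOp, ← integral_indicator measurableSet_Ioi]
  congr 1
  funext t
  by_cases h : x < t
  · rw [indicator_of_mem (mem_Ioi.2 h), max_eq_left (by linarith)]
  · rw [indicator_of_notMem (by simpa using h), max_eq_right (by linarith), jostKernel_zero,
      zero_mul]

theorem integrable_mul_bounded (hp : Integrable p) {g : ℝ → ℂ} (hg : Continuous g) {C : ℝ}
    (hC : ∀ t, ‖g t‖ ≤ C) : Integrable (fun t => p t * g t) :=
  hp.mul_bdd hg.aestronglyMeasurable (Eventually.of_forall hC)

theorem integrable_jostKernel_mul (hl : 0 < l.im) {g : ℝ → ℂ} (hg : Integrable g) (x : ℝ) :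
    Integrable (fun t => jostKernel l (max (t - x) 0) * g t) :=
  hg.bdd_mul (c := 1 / ‖l‖)
    (((continuous_jostKernel l).comp (by fun_prop)).aestronglyMeasurable)
    (Eventually.of_forall fun _ => norm_jostKernel_le hl (le_max_right _ _))

theorem continuous_volterraOp (hp : Integrable p) (hl : 0 < l.im) {g : ℝ → ℂ}
    (hg : Continuous g) {C : ℝ} (hC : ∀ t, ‖g t‖ ≤ C) : Continuous (volterraOp p l g) := by
  have hi := integrable_mul_bounded hp hg hC
  rw [show volterraOp p l g = _ from funext (volterraOp_eq g)]
  refine continuous_of_dominated (bound := fun t => 1 / ‖l‖ * ‖p t * g t‖)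
    (fun x => (integrable_jostKernel_mul hl hi x).aestronglyMeasurable) (fun x => ?_)
    (hi.norm.const_mul _) ?_
  · filter_upwards with t
    rw [norm_mul]
    gcongr
    exact norm_jostKernel_le hl (le_max_right _ _)
  · filter_upwards with t
    exact ((continuous_jostKernel l).comp (by fun_prop)).mul continuous_const

/-- In the norm weighted by exp(2 tail w), with w = |p|/|l|, the operator has norm at most 1/2, by
`integral_mul_exp_tail_le`. -/
theorem norm_volterraOp_le (hp : Integrable p) (hl : 0 < l.im) {g : ℝ → ℂ} {m : ℝ}
    (hm : ∀ t, ‖g t‖ ≤ m * Real.exp (2 * tail (fun s => ‖p s‖ / ‖l‖) t)) (x : ℝ) :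
    ‖volterraOp p l g x‖ ≤ m * Real.exp (2 * tail (fun s => ‖p s‖ / ‖l‖) x) / 2 := by
  set w : ℝ → ℝ := fun s => ‖p s‖ / ‖l‖
  have hw : Integrable w := hp.norm.div_const _
  have hw0 : ∀ t, 0 ≤ w t := fun t => by positivity
  have hm0 : 0 ≤ m := by
    have := (norm_nonneg _).trans (hm 0)
    exact nonneg_of_mul_nonneg_left this (Real.exp_pos _)
  have h1 : ‖volterraOp p l g x‖ ≤ ∫ t in Ioi x, m * (w t * Real.exp (2 * tail w t)) := by
    refine norm_integral_le_of_norm_le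
      ((integrable_mul_exp_tail hw hw0).const_mul m).integrableOn ?_
    filter_upwards [ae_restrict_mem measurableSet_Ioi] with t ht
    have ht0 : 0 ≤ t - x := sub_nonneg.2 (le_of_lt ht)
    calc ‖jostKernel l (t - x) * (p t * g t)‖ = ‖jostKernel l (t - x)‖ * (‖p t‖ * ‖g t‖) := by
          rw [norm_mul, norm_mul]
      _ ≤ 1 / ‖l‖ * (‖p t‖ * (m * Real.exp (2 * tail w t))) := by
          gcongr
          · exact norm_jostKernel_le hl ht0
          · exact hm t
      _ = m * (w t * Real.exp (2 * tail w t)) := by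
          simp only [w]
          ring
  rw [integral_const_mul] at h1
  have h2 := mul_le_mul_of_nonneg_left (integral_mul_exp_tail_le hw hw0 x) hm0
  linarith

theorem volterraOp_sub (hp : Integrable p) (hl : 0 < l.im) {g h : ℝ → ℂ} (hg : Continuous g)
    (hh : Continuous h) {C D : ℝ} (hC : ∀ t, ‖g t‖ ≤ C) (hD : ∀ t, ‖h t‖ ≤ D) (x : ℝ) :
    volterraOp p l (fun t => g t - h t) x = volterraOp p l g x - volterraOp p l h x := by
  simp only [volterraOp_eq]
  rw [← integral_sub (integrable_jostKernel_mul hl (integrable_mul_bounded hp hg hC) x)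
    (integrable_jostKernel_mul hl (integrable_mul_bounded hp hh hD) x)]
  congr 1
  funext t
  ring

/-- The Volterra equation of the Jost solution has a bounded continuous solution: it is a
contraction for a weighted supremum norm. -/
theorem exists_volterra_solution (hp : Integrable p) (hl : 0 < l.im) :
    ∃ f : ℝ → ℂ, Continuous f ∧ (∃ C : ℝ, ∀ x, ‖f x‖ ≤ C) ∧ ∀ x, f x = 1 + volterraOp p l f x := by
  set w : ℝ → ℝ := fun s => ‖p s‖ / ‖l‖ with hwdef
  have hw : Integrable w := hp.norm.div_const _
  have hw0 : ∀ t, 0 ≤ w t := fun t => by positivity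
  set E : ℝ → ℝ := fun x => Real.exp (2 * tail w x) with hE
  have hEc : Continuous E := ((continuous_tail hw).const_mul 2).rexp
  have hE1 : ∀ x, 1 ≤ E x := fun x => Real.one_le_exp (by linarith [tail_nonneg hw0 x])
  have hE0 : ∀ x, 0 < E x := fun x => zero_lt_one.trans_le (hE1 x)
  set M := Real.exp (2 * ∫ t, w t)
  have hEM : ∀ x, E x ≤ M := fun x =>
    Real.exp_le_exp.2 (by linarith [tail_le_integral hw hw0 x])
  have hEhc : ∀ h : BoundedContinuousFunction ℝ ℂ, Continuous fun t => (E t : ℂ) * h t :=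
    fun h => (Complex.continuous_ofReal.comp hEc).mul h.continuous
  have hEh : ∀ (h : BoundedContinuousFunction ℝ ℂ) t, ‖(E t : ℂ) * h t‖ ≤ ‖h‖ * E t := by
    intro h t
    rw [norm_mul, Complex.norm_real, Real.norm_of_nonneg (hE0 t).le, mul_comm]
    exact mul_le_mul_of_nonneg_right (h.norm_coe_le_norm t) (hE0 t).le
  have hEhM : ∀ (h : BoundedContinuousFunction ℝ ℂ) t, ‖(E t : ℂ) * h t‖ ≤ ‖h‖ * M :=
    fun h t => (hEh h t).trans (mul_le_mul_of_nonneg_left (hEM t) (norm_nonneg h))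
  -- Conjugation by the weight E turns the weighted norm into the supremum norm. Since 1 ≤ E ≤ M, a
  -- fixed point h gives the bounded solution E h.
  have hS : ∀ h : BoundedContinuousFunction ℝ ℂ, ∃ k : BoundedContinuousFunction ℝ ℂ,
      ∀ x, k x = ((E x)⁻¹ : ℝ) * (1 + volterraOp p l (fun t => (E t : ℂ) * h t) x) := by
    intro h
    refine ⟨BoundedContinuousFunction.ofNormedAddCommGroup
      (fun x => ((E x)⁻¹ : ℝ) * (1 + volterraOp p l (fun t => (E t : ℂ) * h t) x)) ?_
      (1 + ‖h‖ / 2) ?_, fun x => rfl⟩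
    · exact (Complex.continuous_ofReal.comp (hEc.inv₀ fun x => (hE0 x).ne')).mul
        (continuous_const.add (continuous_volterraOp hp hl (hEhc h) (hEhM h)))
    · intro x
      have h1 := norm_volterraOp_le hp hl (hEh h) x
      rw [norm_mul, Complex.norm_real, norm_inv, Real.norm_of_nonneg (hE0 x).le]
      rw [inv_mul_le_iff₀ (hE0 x)]
      refine (norm_add_le _ _).trans ?_
      rw [norm_one]
      change ‖volterraOp p l (fun t => (E t : ℂ) * h t) x‖ ≤ ‖h‖ * E x / 2 at h1
      nlinarith [hE1 x]
  choose S hS using hS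
  have hcontr : ContractingWith (1 / 2) S := by
    refine ⟨by norm_num, LipschitzWith.of_dist_le_mul fun g h => ?_⟩
    rw [BoundedContinuousFunction.dist_le (by positivity)]
    intro x
    rw [dist_eq_norm, hS, hS, ← mul_sub, add_sub_add_left_eq_sub,
      ← volterraOp_sub hp hl (hEhc g) (hEhc h) (hEhM g) (hEhM h), norm_mul, Complex.norm_real,
      norm_inv, Real.norm_of_nonneg (hE0 x).le, inv_mul_le_iff₀ (hE0 x)]
    have h1 := norm_volterraOp_le hp hl (g := fun t => (E t : ℂ) * g t - (E t : ℂ) * h t)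
      (m := dist g h) (fun t => by
        have := hEh (g - h) t
        rw [BoundedContinuousFunction.coe_sub, Pi.sub_apply, mul_sub] at this
        rwa [dist_eq_norm]) x
    refine h1.trans (le_of_eq ?_)
    rw [NNReal.coe_div, NNReal.coe_one, NNReal.coe_ofNat]
    simp only [hE, hwdef]
    ring
  set h := ContractingWith.fixedPoint S hcontr
  have hfix : S h = h := hcontr.fixedPoint_isFixedPt
  refine ⟨fun t => (E t : ℂ) * h t, hEhc h, ⟨_, hEhM h⟩, fun x => ?_⟩
  have h1 := hS h x
  rw [hfix] at h1
  simp only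
  rw [h1, ← mul_assoc, ← Complex.ofReal_mul, mul_inv_cancel₀ (hE0 x).ne', Complex.ofReal_one,
    one_mul]

end Volterra

variable {q : ℝ → ℝ} {α a : ℝ} {l : ℂ}

theorem hasDerivWithinAt_of_isPrimitive {y z : ℝ → ℂ} (h : IsPrimitive y z)
    (hz : ContinuousOn z (Ici 0)) {x : ℝ} (hx : 0 ≤ x) : HasDerivWithinAt y (z x) (Ici 0) x := by
  -- Constant extension to the left of 0 makes the two-sided fundamental theorem available at the
  -- endpoint.
  set Z : ℝ → ℂ := fun t => z (max t 0) with hZdef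
  have hZ : Continuous Z := hz.comp_continuous (by fun_prop) fun t => mem_Ici.2 (le_max_right _ _)
  have hd : HasDerivAt (fun u => y 0 + ∫ t in (0 : ℝ)..u, Z t) (Z x) x :=
    (intervalIntegral.integral_hasDerivAt_right (hZ.intervalIntegrable _ _)
      hZ.stronglyMeasurable.stronglyMeasurableAtFilter hZ.continuousAt).const_add _
  have hZx : ∀ t, 0 ≤ t → Z t = z t := fun t ht => by simp [hZdef, ht]
  have heq : ∀ u, 0 ≤ u → y u = y 0 + ∫ t in (0 : ℝ)..u, Z t := fun u hu => by
    rw [h.eq_add_integral u hu]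
    congr 1
    refine intervalIntegral.integral_congr fun t ht => ?_
    rw [uIcc_of_le hu] at ht
    exact (hZx t ht.1).symm
  rw [← hZx x hx]
  exact hd.hasDerivWithinAt.congr (fun u hu => heq u hu) (heq x hx)

/-- The Volterra solution f yields y = e^{ilx} f. Splitting its integral into the two tails T and R
gives y, and a candidate z for y', by explicit formulas; in the derivative of y the contributions of
T' and R' cancel. -/
theorem exists_isJostSolution (hq : IntegrableOn (fun x : ℝ => (1 + x) * q x) (Ici 0))
    (hl : 0 < l.im) : ∃ y, IsJostSolution q α a l y := by
  have hl0 : l ≠ 0 := by rintro rfl; simp at hl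
  set c : ℂ := 2 * Complex.I * l with hcdef
  have hc : c ≠ 0 := by simp [hcdef, hl0]
  have hI : Complex.I ^ 2 = -1 := Complex.I_sq
  set p : ℝ → ℂ := (Ioi (0 : ℝ)).indicator (pert q α a l) with hpdef
  have hp : Integrable p := (integrableOn_pert hq).integrable_indicator measurableSet_Ioi
  obtain ⟨f, hfc, ⟨C, hC⟩, hf⟩ := exists_volterra_solution hp hl
  set g : ℝ → ℂ := fun t => p t * f t with hgdef
  have hg : Integrable g := integrable_mul_bounded hp hfc hC
  have hgI := hg.integrableOn (s := Ioi 0)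
  have hgE := integrableOn_exp_mul hl hgI
  set T : ℝ → ℂ := fun x => ∫ t in Ioi x, g t with hT
  set R : ℝ → ℂ := fun x => ∫ t in Ioi x, Complex.exp (2 * Complex.I * l * t) * g t with hR
  have pT : IsPrimitive T (fun x => -g x) := IsPrimitive.tail hgI
  have pR : IsPrimitive R (fun x : ℝ => -(Complex.exp (2 * Complex.I * l * x) * g x)) :=
    IsPrimitive.tail hgE
  have pE := IsPrimitive.exp (Complex.I * l)
  have pE' := IsPrimitive.exp (-(Complex.I * l))
  have pc : IsPrimitive (fun _ => c) (fun _ => 0) :=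
    IsPrimitive.of_hasDerivAt (fun x => hasDerivAt_const x c) continuous_const
  have ec : ∀ x : ℝ, Complex.exp (-(Complex.I * l) * x) * Complex.exp (2 * Complex.I * l * x) =
      Complex.exp (Complex.I * l * x) := fun x => by
    rw [← Complex.exp_add]
    congr 1
    ring
  set y : ℝ → ℂ := fun x => c⁻¹ * (Complex.exp (Complex.I * l * x) * (c - T x) +
    Complex.exp (-(Complex.I * l) * x) * R x) with hy
  set z : ℝ → ℂ := fun x => c⁻¹ * (Complex.I * l) * (Complex.exp (Complex.I * l * x) * (c - T x) -
    Complex.exp (-(Complex.I * l) * x) * R x) with hz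
  have hyf : ∀ x : ℝ, 0 ≤ x → y x = Complex.exp (Complex.I * l * x) * f x := fun x hx => by
    rw [hf x, volterraOp, integral_jostKernel_mul hl hgI hx, ← hcdef]
    change _ = Complex.exp (Complex.I * l * x) *
      (1 + (Complex.exp (-(2 * Complex.I * l * x)) * R x - T x) / c)
    have e : Complex.exp (Complex.I * l * x) * Complex.exp (-(2 * Complex.I * l * x)) =
        Complex.exp (-(Complex.I * l) * x) := by
      rw [← Complex.exp_add]
      congr 1
      ring
    simp only [hy]
    rw [← e]
    field_simp
    ring
  have pyz : IsPrimitive y z := by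
    refine (((pE.mul (pc.sub pT)).add (pE'.mul pR)).const_mul c⁻¹).congr_deriv fun x _ => ?_
    simp only [hz]
    linear_combination -(c⁻¹ * g x) * ec x
  have pz : IsPrimitive z (fun t => ((q t : ℂ) - l ^ 2 * (rho α a t : ℂ)) * y t) := by
    have h1 := ((pE.mul (pc.sub pT)).sub (pE'.mul pR)).const_mul (c⁻¹ * (Complex.I * l))
    have h2 := h1.congr_deriv (h := fun x => p x * y x - l ^ 2 * y x) fun x hx => by
      have e2 : c⁻¹ * (Complex.I * l) * 2 = 1 := by
        rw [hcdef]
        field_simp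
      rw [hyf x hx]
      rw [show l ^ 2 * (Complex.exp (Complex.I * l * x) * f x) = l ^ 2 * y x by rw [hyf x hx]]
      simp only [hy, hgdef]
      linear_combination c⁻¹ * (Complex.I * l) * (p x * f x) * ec x +
        Complex.exp (Complex.I * l * x) * p x * f x * e2 +
        l ^ 2 * c⁻¹ * (Complex.exp (Complex.I * l * x) * (c - T x) +
          Complex.exp (-(Complex.I * l) * x) * R x) * hI
    -- The cut-off p differs from the perturbation at x = 0, so the equation is transferred only for
    -- x > 0, which the integrals do not notice.
    have hae : ∀ x : ℝ, 0 < x → p x * y x - l ^ 2 * y x =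
        ((q x : ℂ) - l ^ 2 * (rho α a x : ℂ)) * y x := fun x hx => by
      rw [hpdef, indicator_of_mem (mem_Ioi.2 hx), pert]
      push_cast
      ring
    refine ⟨fun x hx => (h2.intervalIntegrable x hx).congr fun t ht => ?_, fun x hx => ?_⟩
    · rw [uIoc_of_le hx] at ht
      exact hae t ht.1
    · refine (h2.eq_add_integral x hx).trans ?_
      rw [intervalIntegral.integral_of_le hx, intervalIntegral.integral_of_le hx]
      congr 1
      exact setIntegral_congr_fun measurableSet_Ioc fun t ht => hae t ht.1
  have hd : ∀ x, 0 ≤ x → HasDerivWithinAt y (z x) (Ici 0) x := fun x hx =>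
    hasDerivWithinAt_of_isPrimitive pyz pz.continuousOn hx
  have hhd : ∀ x, 0 ≤ x → halfDeriv y x = z x := fun x hx =>
    (hd x hx).derivWithin (uniqueDiffOn_Ici 0 x hx)
  have limT : Tendsto T atTop (𝓝 0) := tendsto_integral_Ioi_zero tendsto_id
  -- For t > x the factor e^{2il(t-x)} has modulus at most 1, so the term is bounded by the tail of
  -- |g|.
  have limR : Tendsto (fun x : ℝ => Complex.exp (-(2 * Complex.I * l) * x) * R x) atTop (𝓝 0) := by
    have hn : Tendsto (fun x => ∫ t in Ioi x, ‖g t‖) atTop (𝓝 0) :=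
      tendsto_integral_Ioi_zero tendsto_id
    refine squeeze_zero_norm (fun x => ?_) hn
    rw [hR, ← integral_const_mul]
    refine norm_integral_le_of_norm_le hg.norm.integrableOn ?_
    filter_upwards [ae_restrict_mem measurableSet_Ioi] with t ht
    have hxt : x < t := ht
    rw [← mul_assoc, ← Complex.exp_add, norm_mul]
    refine mul_le_of_le_one_left (norm_nonneg _) ?_
    rw [Complex.norm_exp]
    refine Real.exp_le_one_iff.2 ?_
    simp
    nlinarith
  have e3 : ∀ x : ℝ, Complex.exp (Complex.I * l * x) * Complex.exp (-(Complex.I * l * x)) = 1 :=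
    fun x => by rw [← Complex.exp_add]; simp
  have e4 : ∀ x : ℝ, Complex.exp (-(Complex.I * l) * x) * Complex.exp (-(Complex.I * l * x)) =
      Complex.exp (-(2 * Complex.I * l) * x) := fun x => by
    rw [← Complex.exp_add]
    congr 1
    ring
  refine ⟨y, ⟨fun x hx => (hd x hx).differentiableWithinAt, fun x hx => ?_⟩, ?_, ?_⟩
  · rw [hhd x hx, hhd 0 le_rfl]
    exact pz.eq_add_integral x hx
  · have h := ((limT.const_sub c).add limR).const_mul c⁻¹
    rw [sub_zero, add_zero, inv_mul_cancel₀ hc] at h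
    refine h.congr fun x => ?_
    simp only [hy]
    linear_combination -c⁻¹ * (c - T x) * e3 x - c⁻¹ * R x * e4 x
  · have h := ((limT.const_sub c).sub limR).const_mul (c⁻¹ * (Complex.I * l))
    rw [sub_zero, sub_zero, show c⁻¹ * (Complex.I * l) * c = Complex.I * l by field_simp] at h
    refine h.congr' ?_
    filter_upwards [eventually_ge_atTop 0] with x hx
    rw [hhd x hx]
    simp only [hz]
    linear_combination -c⁻¹ * (Complex.I * l) * (c - T x) * e3 x +
      c⁻¹ * (Complex.I * l) * R x * e4 x

theorem isJostSolution_jost (hq : IntegrableOn (fun x : ℝ => (1 + x) * q x) (Ici 0))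
    (hl : 0 < l.im) : IsJostSolution q α a l (jost q α a l) := by
  have h := exists_isJostSolution (α := α) (a := a) hq hl
  rw [jost, dif_pos h]
  exact h.choose_spec

/-! ### Symmetries, and absence of zeros off the imaginary axis -/

theorem setIntegral_Ioi_pos {h : ℝ → ℝ} {X : ℝ} (hi : IntegrableOn h (Ioi 0))
    (h0 : ∀ x, 0 < x → 0 ≤ h x) (hX : ∀ x, X < x → 0 < h x) : 0 < ∫ x in Ioi 0, h x := by
  rw [setIntegral_pos_iff_support_of_nonneg_ae _ hi]
  · refine lt_of_lt_of_le ?_ (measure_mono (s := Ioi (max X 0)) fun x hx => ?_)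
    · simp
    · have hx' := max_lt_iff.1 (mem_Ioi.1 hx)
      exact ⟨(hX x hx'.1).ne', hx'.2⟩
  · filter_upwards [ae_restrict_mem measurableSet_Ioi] with x hx
    exact h0 x hx

theorem halfDeriv_clm_comp {y : ℝ → ℂ} (Φ : ℂ →L[ℝ] ℂ) (hy : DifferentiableOn ℝ y (Ici 0)) {x : ℝ}
    (hx : 0 ≤ x) : halfDeriv (fun t => Φ (y t)) x = Φ (halfDeriv y x) :=
  (Φ.hasFDerivAt.comp_hasDerivWithinAt x (hy x hx).hasDerivWithinAt).derivWithin
    (uniqueDiffOn_Ici 0 x hx)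

/-- A real-linear map that intertwines the equations at `l` and `m` maps Jost solutions to Jost
solutions. -/
theorem IsJostSolution.map {l m : ℂ} {y : ℝ → ℂ}
    (hq : IntegrableOn (fun x : ℝ => (1 + x) * q x) (Ici 0)) (hy : IsJostSolution q α a l y)
    (Φ : ℂ →L[ℝ] ℂ) (hcoeff : ∀ (r s : ℝ) (w : ℂ), Φ ((r - l ^ 2 * s) * w) = (r - m ^ 2 * s) * Φ w)
    (hexp : ∀ (x : ℝ) (w : ℂ), Φ (w * Complex.exp (-(Complex.I * l * x))) =
      Φ w * Complex.exp (-(Complex.I * m * x)))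
    (h1 : Φ 1 = 1) (hI : Φ (Complex.I * l) = Complex.I * m) :
    IsJostSolution q α a m (fun x => Φ (y x)) := by
  have hd := hy.toIsSolution.differentiableOn
  refine ⟨⟨fun x hx => Φ.differentiableAt.comp_differentiableWithinAt x (hd x hx),
    fun x hx => ?_⟩, ?_, ?_⟩
  · rw [halfDeriv_clm_comp Φ hd hx, halfDeriv_clm_comp Φ hd le_rfl,
      hy.toIsSolution.integrated_eq x hx, map_add, ← Φ.intervalIntegral_comp_comm
        ((hy.toIsSolution.isPrimitive_halfDeriv hq).intervalIntegrable x hx)]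
    simp only [hcoeff]
  · have h := (Φ.continuous.tendsto _).comp hy.tendsto_val
    rw [h1] at h
    exact h.congr fun x => hexp x _
  · have h := (Φ.continuous.tendsto _).comp hy.tendsto_deriv
    rw [hI] at h
    refine h.congr' ?_
    filter_upwards [eventually_ge_atTop 0] with x hx
    rw [halfDeriv_clm_comp Φ hd hx]
    exact hexp x _

/-- The equation depends only on l², and the conjugate of e^{ilx} is e^{imx} with m = -l̄, the
reflection of l in the imaginary axis, which stays in the upper half-plane. -/
theorem IsJostSolution.conj {l : ℂ} {y : ℝ → ℂ}
    (hq : IntegrableOn (fun x : ℝ => (1 + x) * q x) (Ici 0)) (hy : IsJostSolution q α a l y) :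
    IsJostSolution q α a (-(starRingEnd ℂ) l) (fun x => (starRingEnd ℂ) (y x)) :=
  hy.map hq Complex.conjCLE.toContinuousLinearMap (fun r s w => by simp)
    (fun x w => by simp [← Complex.exp_conj]) (by simp) (by simp)

/-- On the imaginary axis both the equation and the asymptotics are real. Passing to the real part
avoids any appeal to uniqueness of the Jost solution. -/
theorem IsJostSolution.ofReal_re {t : ℝ} {y : ℝ → ℂ}
    (hq : IntegrableOn (fun x : ℝ => (1 + x) * q x) (Ici 0))
    (hy : IsJostSolution q α a (Complex.I * t) y) :
    IsJostSolution q α a (Complex.I * t) (fun x => ((y x).re : ℂ)) := by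
  have e1 : ∀ x : ℝ, Complex.exp (-(Complex.I * (Complex.I * t) * x)) = (Real.exp (t * x) : ℝ) := by
    intro x
    rw [show -(Complex.I * (Complex.I * t) * x) = ((t * x : ℝ) : ℂ) by
      push_cast; linear_combination -(t * x : ℂ) * Complex.I_mul_I]
    simp
  have e2 : ∀ r s : ℝ, (r : ℂ) - (Complex.I * t) ^ 2 * s = ((r + t ^ 2 * s : ℝ) : ℂ) := by
    intro r s
    push_cast
    linear_combination -(t ^ 2 * s : ℂ) * Complex.I_sq
  have e3 : Complex.I * (Complex.I * t) = ((-t : ℝ) : ℂ) := by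
    push_cast
    linear_combination (t : ℂ) * Complex.I_mul_I
  refine hy.map hq (Complex.ofRealCLM.comp Complex.reCLM) (fun r s w => ?_) (fun x w => ?_)
    (by simp) ?_
  · rw [e2, ContinuousLinearMap.comp_apply, ContinuousLinearMap.comp_apply, Complex.reCLM_apply,
      Complex.re_ofReal_mul]
    simp
  · rw [e1]
    simp [-Complex.ofReal_exp]
  · rw [e3]
    simp

/-- The three sign conditions make the bracket nonnegative when Im l > 0. -/
theorem bdryCoeff_mul_conj_im (A B : Fin 3 → ℝ) (l : ℂ) :
    (bdryCoeff A l * (starRingEnd ℂ) (bdryCoeff B l)).im =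
      l.re * (-(A 0 * B 1 - A 1 * B 0) - 2 * l.im * (A 0 * B 2 - A 2 * B 0) +
        (A 1 * B 2 - A 2 * B 1) * (l.re ^ 2 + l.im ^ 2)) := by
  simp [bdryCoeff, pow_two]
  ring

/-- The zeros of the characteristic function in the upper half plane are purely imaginary. -/
theorem re_eq_zero_of_charFun_eq_zero (hq : IntegrableOn (fun x : ℝ => (1 + x) * q x) (Ici 0))
    (hα : 0 < α) {A B : Fin 3 → ℝ}
    (hδ₁ : A 0 * B 1 - A 1 * B 0 ≤ 0)
    (hδ₂ : A 0 * B 2 - A 2 * B 0 ≤ 0)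
    (hδ₃ : 0 ≤ A 1 * B 2 - A 2 * B 1)
    (hbdry : ∀ l : ℂ, 0 < l.im → l.re ≠ 0 → ¬ (bdryCoeff A l = 0 ∧ bdryCoeff B l = 0))
    {l : ℂ} (hl : 0 < l.im) (hE : charFun q α a A B l = 0) : l.re = 0 := by
  by_contra hre
  have hy : IsJostSolution q α a l (jost q α a l) := isJostSolution_jost hq hl
  have hz := hy.conj hq
  have hlc : 0 < (-(starRingEnd ℂ) l).im := by simpa using hl
  have hW := hy.wronskian_zero hq hz hl hlc
  have hint := hy.integrableOn_rho_mul hz hl hlc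
  rw [charFun] at hE
  have hd := halfDeriv_clm_comp Complex.conjCLE.toContinuousLinearMap
    hy.toIsSolution.differentiableOn le_rfl
  simp only [ContinuousLinearEquiv.coe_coe, Complex.conjCLE_apply] at hd
  rw [hd] at hW
  set y := jost q α a l
  have hcast : ∀ x, (rho α a x : ℂ) * (y x * (starRingEnd ℂ) (y x)) =
      ((rho α a x * Complex.normSq (y x) : ℝ) : ℂ) := fun x => by
    rw [Complex.mul_conj]
    push_cast
    ring
  simp_rw [hcast] at hW hint
  rw [integral_complex_ofReal] at hW
  set N := ∫ x in Ioi 0, rho α a x * Complex.normSq (y x)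
  have hN : 0 < N := by
    have hne : ∀ᶠ x in atTop, y x ≠ 0 := by
      filter_upwards [hy.tendsto_val.eventually_ne one_ne_zero] with x hx h0
      simp [h0] at hx
    obtain ⟨X, hX⟩ := eventually_atTop.1 hne
    refine setIntegral_Ioi_pos (X := X) ?_ (fun x _ => ?_) fun x hx => ?_
    · have h := hint.re
      simp only [RCLike.re_to_complex, Complex.ofReal_re] at h
      exact h
    · exact mul_nonneg (rho_pos hα a x).le (Complex.normSq_nonneg _)
    · exact mul_pos (rho_pos hα a x) (Complex.normSq_pos.2 (hX x hx.le))
  have hWim := congrArg Complex.im hW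
  -- Here l² - (-l̄)² = 4i Re l Im l, and the Wronskian of y and ȳ is 2i Im(y'ȳ).
  have hWim' : (halfDeriv y 0 * (starRingEnd ℂ) (y 0)).im = 2 * l.re * l.im * N := by
    simp [pow_two] at hWim ⊢
    linarith
  by_cases hB : bdryCoeff B l = 0
  · have hA : bdryCoeff A l ≠ 0 := fun h => hbdry l hl hre ⟨h, hB⟩
    rw [hB, zero_mul, zero_add] at hE
    have hy0 : y 0 = 0 := (mul_eq_zero.1 hE).resolve_left hA
    rw [hy0] at hWim'
    simp only [map_zero, mul_zero, Complex.zero_im] at hWim'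
    have : 2 * l.re * l.im * N ≠ 0 := by positivity
    exact this hWim'.symm
  -- E(l) = 0 is multiplied by the conjugate of B(l)y(0). In the imaginary part both terms carry the
  -- factor Re l; after division a positive and a nonnegative number sum to zero.
  · have h1 : (Complex.normSq (bdryCoeff B l) : ℂ) * (halfDeriv y 0 * (starRingEnd ℂ) (y 0)) +
        (Complex.normSq (y 0) : ℂ) * (bdryCoeff A l * (starRingEnd ℂ) (bdryCoeff B l)) = 0 := by
      rw [← Complex.mul_conj, ← Complex.mul_conj]
      linear_combination (starRingEnd ℂ) (bdryCoeff B l) * (starRingEnd ℂ) (y 0) * hE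
    have h2 := congrArg Complex.im h1
    rw [Complex.add_im, Complex.im_ofReal_mul, Complex.im_ofReal_mul, hWim',
      bdryCoeff_mul_conj_im, Complex.zero_im] at h2
    have hBpos : 0 < Complex.normSq (bdryCoeff B l) := Complex.normSq_pos.2 hB
    have h3 : Complex.normSq (bdryCoeff B l) * (2 * l.im * N) + Complex.normSq (y 0) *
        (-(A 0 * B 1 - A 1 * B 0) - 2 * l.im * (A 0 * B 2 - A 2 * B 0) +
        (A 1 * B 2 - A 2 * B 1) * (l.re ^ 2 + l.im ^ 2)) = 0 := by
      refine (mul_eq_zero.1 (?_ : l.re * _ = 0)).resolve_left hre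
      linear_combination h2
    have h4 : 0 < Complex.normSq (bdryCoeff B l) * (2 * l.im * N) := by positivity
    have h5 : 0 ≤ -(A 0 * B 1 - A 1 * B 0) - 2 * l.im * (A 0 * B 2 - A 2 * B 0) +
        (A 1 * B 2 - A 2 * B 1) * (l.re ^ 2 + l.im ^ 2) := by
      have e1 := mul_nonneg hl.le (neg_nonneg.2 hδ₂)
      have e2 := mul_nonneg hδ₃ (by positivity : 0 ≤ l.re ^ 2 + l.im ^ 2)
      linarith
    have h6 := mul_nonneg (Complex.normSq_nonneg (y 0)) h5
    linarith

/-! ### Real Jost solutions on the imaginary axis -/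

/-- The real part of the Jost solution at `it`; it is again a Jost solution. -/
noncomputable def realJost (q : ℝ → ℝ) (α a t x : ℝ) : ℝ := (jost q α a (Complex.I * t) x).re

/-- The derivative of `realJost`. -/
noncomputable def realJostDeriv (q : ℝ → ℝ) (α a t x : ℝ) : ℝ :=
  (halfDeriv (jost q α a (Complex.I * t)) x).re

/-- `e^{tx}` times the real Jost solution at `it`; it tends to `1` at infinity. -/
noncomputable def jostProfile (q : ℝ → ℝ) (α a t x : ℝ) : ℝ :=
  realJost q α a t x * Real.exp (t * x)

/-- The weighted inner product of two real Jost solutions. -/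
noncomputable def overlap (q : ℝ → ℝ) (α a s t : ℝ) : ℝ :=
  ∫ x in Ioi 0, rho α a x * (realJost q α a s x * realJost q α a t x)

/-- The Volterra kernel on the imaginary axis. -/
noncomputable def realKernel (t u : ℝ) : ℝ := (1 - Real.exp (-(2 * t * u))) / (2 * t)

/-- The perturbation on the imaginary axis. -/
noncomputable def realPert (q : ℝ → ℝ) (α a t x : ℝ) : ℝ := q x - t ^ 2 * (1 - rho α a x)

theorem I_mul_im_pos {t : ℝ} (ht : 0 < t) : 0 < (Complex.I * (t : ℂ)).im := by simpa using ht

theorem isJostSolution_realJost (hq : IntegrableOn (fun x : ℝ => (1 + x) * q x) (Ici 0)) {t : ℝ}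
    (ht : 0 < t) :
    IsJostSolution q α a (Complex.I * t) (fun x => (realJost q α a t x : ℂ)) :=
  (isJostSolution_jost hq (I_mul_im_pos ht)).ofReal_re hq

theorem halfDeriv_realJost (hq : IntegrableOn (fun x : ℝ => (1 + x) * q x) (Ici 0)) {t : ℝ}
    (ht : 0 < t) {x : ℝ} (hx : 0 ≤ x) :
    halfDeriv (fun x => (realJost q α a t x : ℂ)) x = (realJostDeriv q α a t x : ℂ) :=
  halfDeriv_clm_comp (Complex.ofRealCLM.comp Complex.reCLM)
    (isJostSolution_jost hq (I_mul_im_pos ht)).toIsSolution.differentiableOn hx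

theorem integrableOn_overlap (hq : IntegrableOn (fun x : ℝ => (1 + x) * q x) (Ici 0)) {s t : ℝ}
    (hs : 0 < s) (ht : 0 < t) : IntegrableOn (fun x => rho α a x *
      (realJost q α a s x * realJost q α a t x)) (Ioi 0) := by
  have h := ((isJostSolution_realJost (α := α) (a := a) hq hs).integrableOn_rho_mul
    (isJostSolution_realJost hq ht) (I_mul_im_pos hs) (I_mul_im_pos ht)).re
  simpa [IntegrableOn] using h

theorem overlap_comm (s t : ℝ) : overlap q α a s t = overlap q α a t s := by
  simp only [overlap, mul_comm (realJost q α a s _)]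

theorem wronskian_realJost (hq : IntegrableOn (fun x : ℝ => (1 + x) * q x) (Ici 0)) {s t : ℝ}
    (hs : 0 < s) (ht : 0 < t) :
    realJostDeriv q α a s 0 * realJost q α a t 0 - realJost q α a s 0 * realJostDeriv q α a t 0 =
      (t ^ 2 - s ^ 2) * overlap q α a s t := by
  have h := (isJostSolution_realJost (α := α) (a := a) hq hs).wronskian_zero hq
    (isJostSolution_realJost hq ht) (I_mul_im_pos hs) (I_mul_im_pos ht)
  rw [halfDeriv_realJost hq hs le_rfl, halfDeriv_realJost hq ht le_rfl] at h
  simp_rw [← Complex.ofReal_mul] at h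
  rw [integral_complex_ofReal] at h
  rw [show (Complex.I * (s : ℂ)) ^ 2 - (Complex.I * (t : ℂ)) ^ 2 = ((t ^ 2 - s ^ 2 : ℝ) : ℂ) by
    push_cast; linear_combination ((s : ℂ) ^ 2 - (t : ℂ) ^ 2) * Complex.I_sq] at h
  exact_mod_cast h

theorem exp_neg_I_mul (t x : ℝ) :
    Complex.exp (-(Complex.I * (Complex.I * t) * x)) = (Real.exp (t * x) : ℝ) := by
  rw [show -(Complex.I * (Complex.I * t) * x) = ((t * x : ℝ) : ℂ) by
    push_cast; linear_combination -(t * x : ℂ) * Complex.I_mul_I]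
  simp

theorem jostKernel_I_mul (t u : ℝ) : jostKernel (Complex.I * t) u = (realKernel t u : ℂ) := by
  have h1 : 2 * Complex.I * (Complex.I * t) = ((-(2 * t) : ℝ) : ℂ) := by
    push_cast
    linear_combination 2 * (t : ℂ) * Complex.I_mul_I
  rw [jostKernel, realKernel, h1, ← Complex.ofReal_mul, ← Complex.ofReal_exp]
  push_cast
  rw [div_neg, ← neg_div, neg_sub]
  simp

theorem pert_I_mul (t x : ℝ) : pert q α a (Complex.I * t) x = (realPert q α a t x : ℂ) := by
  rw [pert, realPert]
  push_cast
  linear_combination (t : ℂ) ^ 2 * (1 - rho α a x) * Complex.I_sq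

theorem ofReal_jostProfile (t x : ℝ) : (jostProfile q α a t x : ℂ) =
    (realJost q α a t x : ℂ) * Complex.exp (-(Complex.I * (Complex.I * t) * x)) := by
  rw [exp_neg_I_mul, jostProfile]
  push_cast
  rfl

theorem realJost_eq (t x : ℝ) :
    realJost q α a t x = jostProfile q α a t x * Real.exp (-(t * x)) := by
  rw [jostProfile, mul_assoc, ← Real.exp_add, add_neg_cancel, Real.exp_zero, mul_one]

theorem jostProfile_volterra (hq : IntegrableOn (fun x : ℝ => (1 + x) * q x) (Ici 0)) {t : ℝ}
    (ht : 0 < t) {x : ℝ} (hx : 0 ≤ x) : jostProfile q α a t x = 1 + ∫ s in Ioi x,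
      realKernel t (s - x) * (realPert q α a t s * jostProfile q α a t s) := by
  have h := (isJostSolution_realJost (α := α) (a := a) hq ht).volterra hq (I_mul_im_pos ht) hx
  simp only [jostKernel_I_mul, pert_I_mul, ← ofReal_jostProfile, ← Complex.ofReal_mul] at h
  rw [integral_complex_ofReal] at h
  exact_mod_cast h

theorem tendsto_jostProfile (hq : IntegrableOn (fun x : ℝ => (1 + x) * q x) (Ici 0)) {t : ℝ}
    (ht : 0 < t) : Tendsto (jostProfile q α a t) atTop (𝓝 1) := by
  have h := (isJostSolution_realJost (α := α) (a := a) hq ht).tendsto_val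
  simp only [← ofReal_jostProfile] at h
  have h' := (Complex.continuous_re.tendsto _).comp h
  rw [Complex.one_re] at h'
  exact h'

theorem continuousOn_realJost (hq : IntegrableOn (fun x : ℝ => (1 + x) * q x) (Ici 0)) {t : ℝ}
    (ht : 0 < t) : ContinuousOn (realJost q α a t) (Ici 0) :=
  Complex.continuous_re.comp_continuousOn
    (isJostSolution_jost (α := α) (a := a) hq (I_mul_im_pos ht)).toIsSolution.continuousOn

theorem continuousOn_jostProfile (hq : IntegrableOn (fun x : ℝ => (1 + x) * q x) (Ici 0)) {t : ℝ}
    (ht : 0 < t) : ContinuousOn (jostProfile q α a t) (Ici 0) :=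
  (continuousOn_realJost hq ht).mul (Continuous.continuousOn (by fun_prop))

theorem exists_abs_jostProfile_le (hq : IntegrableOn (fun x : ℝ => (1 + x) * q x) (Ici 0)) {t : ℝ}
    (ht : 0 < t) : ∃ C : ℝ, 0 ≤ C ∧ ∀ x, 0 ≤ x → |jostProfile q α a t x| ≤ C := by
  obtain ⟨C, hC0, hC⟩ := (isJostSolution_realJost (α := α) (a := a) hq ht).exists_norm_le
  refine ⟨C, hC0, fun x hx => ?_⟩
  have := hC x hx
  rwa [← ofReal_jostProfile, Complex.norm_real, Real.norm_eq_abs] at this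

theorem realKernel_nonneg {t : ℝ} (ht : 0 < t) {u : ℝ} (hu : 0 ≤ u) : 0 ≤ realKernel t u :=
  div_nonneg (sub_nonneg.2 (Real.exp_le_one_iff.2 (by
    have : 0 ≤ 2 * t * u := by positivity
    linarith))) (by positivity)

/-- Unlike 1/(2t), this bound survives t → 0; its price is the first moment of the potential. -/
theorem realKernel_le_self {t : ℝ} (ht : 0 < t) (u : ℝ) : realKernel t u ≤ u := by
  rw [realKernel, div_le_iff₀ (by positivity)]
  have := Real.add_one_le_exp (-(2 * t * u))
  linarith

theorem realKernel_le {t : ℝ} (ht : 0 < t) (u : ℝ) : realKernel t u ≤ 1 / (2 * t) := by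
  unfold realKernel
  gcongr
  linarith [Real.exp_pos (-(2 * t * u))]

theorem continuous_realKernel (t : ℝ) : Continuous (realKernel t) := by
  unfold realKernel
  fun_prop

/-- The kernel is ∫₀ᵘ e^{-2tr} dr. It decreases in t, and the difference of two kernels increases in
u towards the difference of their limits 1/(2s) and 1/(2t). -/
theorem abs_realKernel_sub_le {s t : ℝ} (hs : 0 < s) (ht : 0 < t) {u : ℝ} (hu : 0 ≤ u) :
    |realKernel s u - realKernel t u| ≤ |1 / (2 * s) - 1 / (2 * t)| := by
  wlog hst : s ≤ t generalizing s t
  · rw [abs_sub_comm, abs_sub_comm (1 / (2 * s))]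
    exact this ht hs (le_of_not_ge hst)
  have h1 : 1 / (2 * t) ≤ 1 / (2 * s) := by gcongr
  have h2 : realKernel t u ≤ realKernel s u := by
    -- Convexity of exp between 0 and -2tu with weight s/t.
    have hc := convexOn_exp.2 (mem_univ 0) (mem_univ (-(2 * t * u)))
      (sub_nonneg.2 ((div_le_one ht).2 hst)) (div_nonneg hs.le ht.le) (by ring)
    simp only [smul_eq_mul, mul_zero, zero_add, Real.exp_zero, mul_one] at hc
    rw [show s / t * -(2 * t * u) = -(2 * s * u) by field_simp] at hc
    rw [realKernel, realKernel, div_le_div_iff₀ (by positivity) (by positivity)]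
    have h3 := mul_le_mul_of_nonneg_left hc ht.le
    have h4 : t * (1 - s / t + s / t * Real.exp (-(2 * t * u))) =
        t - s + s * Real.exp (-(2 * t * u)) := by field_simp
    rw [h4] at h3
    nlinarith
  rw [abs_of_nonneg (by linarith), abs_of_nonneg (by linarith)]
  have h3 : Real.exp (-(2 * t * u)) / (2 * t) ≤ Real.exp (-(2 * s * u)) / (2 * s) := by
    gcongr
  rw [realKernel, realKernel, sub_div, sub_div]
  linarith

/-! ### Uniform estimates and local positivity of the overlap -/

/-- The common majorant `|q| + |1 - ρ|` of the perturbations. -/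
noncomputable def majorant (q : ℝ → ℝ) (α a x : ℝ) : ℝ := |q x| + |1 - rho α a x|

theorem majorant_nonneg (q : ℝ → ℝ) (α a x : ℝ) : 0 ≤ majorant q α a x := by
  unfold majorant
  positivity

theorem integrableOn_majorant (hq : IntegrableOn (fun x : ℝ => (1 + x) * q x) (Ici 0)) :
    IntegrableOn (majorant q α a) (Ioi 0) :=
  (integrableOn_of_one_add_mul (integrableOn_Ioi_of_Ici hq)).abs.add
    (integrableOn_of_one_add_mul (integrableOn_one_add_mul_one_sub_rho α a)).abs

theorem integrableOn_id_mul_majorant (hq : IntegrableOn (fun x : ℝ => (1 + x) * q x) (Ici 0)) :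
    IntegrableOn (fun x => x * majorant q α a x) (Ioi 0) := by
  have h := (integrableOn_id_mul_of_one_add_mul (integrableOn_Ioi_of_Ici hq)).abs.add
    (integrableOn_id_mul_of_one_add_mul (integrableOn_one_add_mul_one_sub_rho α a)).abs
  refine IntegrableOn.congr_fun h (fun x hx => ?_) measurableSet_Ioi
  have hx0 : (0 : ℝ) < x := hx
  simp only [majorant, Pi.add_apply, abs_mul, abs_of_pos hx0]
  ring

theorem abs_realPert_le {t T : ℝ} (hT : t ^ 2 ≤ T) (x : ℝ) :
    |realPert q α a t x| ≤ (1 + T) * majorant q α a x := by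
  have hT0 : 0 ≤ T := (sq_nonneg t).trans hT
  rw [realPert, majorant]
  refine (abs_sub _ _).trans ?_
  rw [abs_mul, abs_of_nonneg (sq_nonneg t)]
  nlinarith [abs_nonneg (q x), abs_nonneg (1 - rho α a x)]

/-- Kernel and profile carry separate parameters because comparing two profiles produces mixed
terms. -/
theorem integrableOn_volterra {s t : ℝ} (hq : IntegrableOn (fun x : ℝ => (1 + x) * q x) (Ici 0))
    (hs : 0 < s) (ht : 0 < t) {x : ℝ} (hx : 0 ≤ x) : IntegrableOn (fun r =>
      realKernel s (r - x) * (realPert q α a s r * jostProfile q α a t r)) (Ioi x) := by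
  obtain ⟨C, hC0, hC⟩ := exists_abs_jostProfile_le (α := α) (a := a) hq ht
  have hp : IntegrableOn (realPert q α a s) (Ioi 0) :=
    (integrableOn_of_one_add_mul (integrableOn_Ioi_of_Ici hq)).sub
      ((integrableOn_of_one_add_mul (integrableOn_one_add_mul_one_sub_rho α a)).const_mul _)
  have h1 : IntegrableOn (fun r => realPert q α a s r * jostProfile q α a t r) (Ioi 0) := by
    refine Integrable.mul_bdd (c := C) hp
      (((continuousOn_jostProfile hq ht).mono Ioi_subset_Ici_self).aestronglyMeasurable
        measurableSet_Ioi) ?_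
    filter_upwards [ae_restrict_mem measurableSet_Ioi] with r hr
    exact hC r (le_of_lt hr)
  refine Integrable.bdd_mul (c := 1 / (2 * s)) (h1.mono_set (Ioi_subset_Ioi hx))
    ((continuous_realKernel s).comp (by fun_prop)).aestronglyMeasurable ?_
  filter_upwards [ae_restrict_mem measurableSet_Ioi] with r hr
  have hr0 : 0 ≤ r - x := sub_nonneg.2 (le_of_lt hr)
  rw [Real.norm_of_nonneg (realKernel_nonneg hs hr0)]
  exact realKernel_le hs _

theorem overlap_integrand (s t x : ℝ) : rho α a x * (realJost q α a s x * realJost q α a t x) =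
    rho α a x * (jostProfile q α a s x * jostProfile q α a t x) * Real.exp (-(s + t) * x) := by
  rw [realJost_eq, realJost_eq, show -(s + t) * x = -(s * x) + -(t * x) by ring, Real.exp_add]
  ring

theorem abs_rho_le (α a x : ℝ) : |rho α a x| ≤ α ^ 2 + 1 := by
  rw [abs_of_nonneg]
  · exact rho_le α a x
  · unfold rho
    split_ifs <;> positivity

/-- Bounds on the Jost solutions that are uniform down to the bottom of the spectrum. -/
theorem exists_uniform_bound (hq : IntegrableOn (fun x : ℝ => (1 + x) * q x) (Ici 0)) :
    ∃ C X : ℝ, 0 ≤ C ∧ 0 < X ∧ a ≤ X ∧ ∀ t, 0 < t → t ≤ 1 →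
      (∀ x, 0 ≤ x → |jostProfile q α a t x| ≤ C) ∧ ∀ x, X ≤ x → 1 / 2 ≤ jostProfile q α a t x := by
  -- For t ≤ 1 the kernel is at most r - x ≤ r and the perturbation at most twice the majorant, so w
  -- dominates independently of t.
  set w : ℝ → ℝ := fun x => x * (2 * majorant q α a x) with hwdef
  have hw : IntegrableOn w (Ioi 0) := by
    refine IntegrableOn.congr_fun ((integrableOn_id_mul_majorant (α := α) (a := a) hq).const_mul 2)
      (fun x _ => ?_) measurableSet_Ioi
    simp only [hwdef]
    ring
  have hw0 : ∀ t, 0 < t → 0 ≤ w t := fun t ht =>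
    mul_nonneg ht.le (mul_nonneg zero_le_two (majorant_nonneg q α a t))
  have hmaj : ∀ t, 0 < t → t ≤ 1 → ∀ x, 0 ≤ x → ∀ r, x < r →
      |realKernel t (r - x) * (realPert q α a t r * jostProfile q α a t r)| ≤
        w r * |jostProfile q α a t r| := by
    intro t ht ht1 x hx r hr
    have h1 : |realKernel t (r - x)| ≤ r := by
      rw [abs_of_nonneg (realKernel_nonneg ht (by linarith))]
      exact (realKernel_le_self ht _).trans (by linarith)
    have h2 : |realPert q α a t r| ≤ 2 * majorant q α a r := by
      have := abs_realPert_le (q := q) (α := α) (a := a) (T := 1) (t := t) (by nlinarith) r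
      linarith
    rw [abs_mul, abs_mul, ← mul_assoc]
    exact mul_le_mul_of_nonneg_right
      (mul_le_mul h1 h2 (abs_nonneg _) (hx.trans hr.le)) (abs_nonneg _)
  set C := 2 * 1 * Real.exp (2 * ∫ t in Ioi 0, w t) with hCdef
  have hC : ∀ t, 0 < t → t ≤ 1 → ∀ x, 0 ≤ x → |jostProfile q α a t x| ≤ C := by
    intro t ht ht1 x hx
    obtain ⟨M, hM0, hM⟩ := exists_abs_jostProfile_le (α := α) (a := a) hq ht
    refine le_exp_of_le_add_integral_Ioi (g := fun x => |jostProfile q α a t x|) hw hw0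
      (fun _ _ => abs_nonneg _) hM zero_le_one (fun x hx => ?_) hx
    have hi : IntegrableOn (fun r => w r * |jostProfile q α a t r|) (Ioi x) := by
      refine Integrable.mul_bdd (c := M) (hw.mono_set (Ioi_subset_Ioi hx))
        (((continuousOn_jostProfile hq ht).abs.mono
          (Ioi_subset_Ici hx)).aestronglyMeasurable measurableSet_Ioi) ?_
      filter_upwards [ae_restrict_mem measurableSet_Ioi] with r hr
      rw [Real.norm_eq_abs, abs_abs]
      exact hM r (hx.trans (le_of_lt hr))
    have h1 : |∫ s in Ioi x, realKernel t (s - x) * (realPert q α a t s * jostProfile q α a t s)| ≤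
        ∫ s in Ioi x, w s * |jostProfile q α a t s| := by
      rw [← Real.norm_eq_abs]
      refine norm_integral_le_of_norm_le hi ?_
      filter_upwards [ae_restrict_mem measurableSet_Ioi] with r hr
      exact hmaj t ht ht1 x hx r hr
    rw [jostProfile_volterra hq ht hx]
    refine (abs_add_le _ _).trans ?_
    rw [abs_one]
    linarith
  have hC0 : 0 ≤ C := by positivity
  have hlim : Tendsto (fun x => C * ∫ s in Ioi x, w s) atTop (𝓝 (C * 0)) :=
    Tendsto.const_mul C (tendsto_integral_Ioi_zero tendsto_id)
  rw [mul_zero] at hlim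
  obtain ⟨X, hX⟩ := eventually_atTop.1 (hlim.eventually_lt_const (by norm_num : (0 : ℝ) < 1 / 2))
  refine ⟨C, max X (max a 1), hC0, by positivity, (le_max_left _ _).trans (le_max_right _ _),
    fun t ht ht1 => ⟨hC t ht ht1, fun x hx => ?_⟩⟩
  have hx0 : 0 ≤ x := zero_le_one.trans
    (((le_max_right a 1).trans (le_max_right _ _)).trans hx)
  have h1 : |∫ s in Ioi x, realKernel t (s - x) * (realPert q α a t s * jostProfile q α a t s)| ≤
      ∫ s in Ioi x, C * w s := by
    rw [← Real.norm_eq_abs]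
    refine norm_integral_le_of_norm_le ((hw.mono_set (Ioi_subset_Ioi hx0)).const_mul C) ?_
    filter_upwards [ae_restrict_mem measurableSet_Ioi] with r hr
    have hr0 : 0 < r := hx0.trans_lt hr
    refine (hmaj t ht ht1 x hx0 r hr).trans ?_
    rw [mul_comm]
    exact mul_le_mul_of_nonneg_right (hC t ht ht1 r hr0.le) (hw0 r hr0)
  rw [integral_const_mul] at h1
  have h2 := hX x ((le_max_left _ _).trans hx)
  have h3 := (abs_le.1 h1).1
  rw [jostProfile_volterra hq ht hx0]
  linarith

/-- On (0, X] the integral is bounded by D. Beyond X both profiles are at least 1/2 and ρ = 1, so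
the rest is at least e^{-(s+t)X} / (4(s+t)), which blows up as s + t → 0. -/
theorem overlap_pos_near_zero (hq : IntegrableOn (fun x : ℝ => (1 + x) * q x) (Ici 0)) :
    ∃ ε : ℝ, 0 < ε ∧ ∀ s t, 0 < s → 0 < t → s < ε → t < ε → 0 < overlap q α a s t := by
  obtain ⟨C, X, hC0, hX, haX, hb⟩ := exists_uniform_bound (α := α) (a := a) hq
  set D := (α ^ 2 + 1) * C ^ 2 * X with hD
  have hD0 : 0 ≤ D := by positivity
  -- The bound 1/2 gives s + t ≤ 1, hence e^{-(s+t)X} ≥ e^{-X}; the second bound then makes the tail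
  -- at least D + 1.
  refine ⟨min (1 / 2) (Real.exp (-X) / (8 * (D + 1))), by positivity, fun s t hs ht hsε htε => ?_⟩
  have hs1 := hsε.trans_le (min_le_left _ _)
  have ht1 := htε.trans_le (min_le_left _ _)
  have hs2 := hsε.trans_le (min_le_right _ _)
  have ht2 := htε.trans_le (min_le_right _ _)
  obtain ⟨hsC, hsX⟩ := hb s hs (by linarith)
  obtain ⟨htC, htX⟩ := hb t ht (by linarith)
  have hint := integrableOn_overlap (α := α) (a := a) hq hs ht
  have hexp : IntegrableOn (fun x : ℝ => Real.exp (-(s + t) * x)) (Ioi X) :=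
    exp_neg_integrableOn_Ioi X (by linarith)
  rw [overlap, ← Ioc_union_Ioi_eq_Ioi hX.le, setIntegral_union Ioc_disjoint_Ioi_same
    measurableSet_Ioi (hint.mono_set Ioc_subset_Ioi_self)
    (hint.mono_set (Ioi_subset_Ioi hX.le))]
  have h1 : |∫ x in Ioc 0 X, rho α a x * (realJost q α a s x * realJost q α a t x)| ≤ D := by
    have := norm_setIntegral_le_of_norm_le_const (μ := volume) (s := Ioc 0 X)
      (f := fun x => rho α a x * (realJost q α a s x * realJost q α a t x))
      (C := (α ^ 2 + 1) * C ^ 2) (by simp) (fun x hx => ?_)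
    · rw [Real.norm_eq_abs] at this
      refine this.trans (le_of_eq ?_)
      simp [hD, Measure.real, hX.le]
    · rw [overlap_integrand, norm_mul, norm_mul, norm_mul, Real.norm_eq_abs, Real.norm_eq_abs,
        Real.norm_eq_abs, Real.norm_of_nonneg (Real.exp_pos _).le]
      have e1 : Real.exp (-(s + t) * x) ≤ 1 := Real.exp_le_one_iff.2 (by nlinarith [hx.1])
      have e2 := abs_rho_le α a x
      have e3 := hsC x hx.1.le
      have e4 := htC x hx.1.le
      calc |rho α a x| * (|jostProfile q α a s x| * |jostProfile q α a t x|) *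
            Real.exp (-(s + t) * x) ≤ (α ^ 2 + 1) * (C * C) * 1 := by gcongr
        _ = (α ^ 2 + 1) * C ^ 2 := by ring
  have h2 : ∫ x in Ioi X, 1 / 4 * Real.exp (-(s + t) * x) ≤
      ∫ x in Ioi X, rho α a x * (realJost q α a s x * realJost q α a t x) := by
    refine setIntegral_mono_on (hexp.const_mul _) (hint.mono_set (Ioi_subset_Ioi hX.le))
      measurableSet_Ioi fun x hx => ?_
    have hx0 : X < x := hx
    rw [overlap_integrand]
    have e1 : rho α a x = 1 := by
      rw [rho, if_neg]
      linarith
    rw [e1, one_mul]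
    refine mul_le_mul_of_nonneg_right ?_ (Real.exp_pos _).le
    nlinarith [hsX x hx0.le, htX x hx0.le]
  rw [integral_const_mul, integral_exp_mul_Ioi (by linarith) X] at h2
  have h3 : D + 1 ≤ 1 / 4 * (-Real.exp (-(s + t) * X) / -(s + t)) := by
    rw [neg_div_neg_eq]
    have e1 : Real.exp (-X) ≤ Real.exp (-(s + t) * X) := by
      gcongr
      nlinarith
    have e2 : (s + t) * (4 * (D + 1)) ≤ Real.exp (-X) := by
      rw [lt_div_iff₀ (by positivity)] at hs2 ht2
      linarith
    rw [mul_div_assoc', le_div_iff₀ (by linarith)]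
    linarith
  have := (abs_le.1 h1).1
  linarith

/-- The profiles depend continuously on the spectral parameter, uniformly in `x`. -/
theorem eventually_abs_jostProfile_sub_le
    (hq : IntegrableOn (fun x : ℝ => (1 + x) * q x) (Ici 0)) {t δ : ℝ} (ht : 0 < t) (hδ : 0 < δ) :
    ∀ᶠ s in 𝓝 t, ∀ x, 0 ≤ x → |jostProfile q α a s x - jostProfile q α a t x| ≤ δ := by
  obtain ⟨C, hC0, hC⟩ := exists_abs_jostProfile_le (α := α) (a := a) hq ht
  set T := (2 * t) ^ 2 with hT
  set w : ℝ → ℝ := fun x => (1 / t * (1 + T)) * majorant q α a x with hwdef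
  have hmi := integrableOn_majorant (α := α) (a := a) hq
  have hw : IntegrableOn w (Ioi 0) := hmi.const_mul _
  have hw0 : ∀ x, 0 ≤ w x := fun x => mul_nonneg (by positivity) (majorant_nonneg q α a x)
  set m := ∫ x in Ioi 0, majorant q α a x
  have hm0 : 0 ≤ m := setIntegral_nonneg measurableSet_Ioi fun x _ => majorant_nonneg q α a x
  -- `d s` times the majorant bounds the change of kernel times perturbation between t and s, and `d
  -- t = 0`.
  set d : ℝ → ℝ := fun s => |1 / (2 * s) - 1 / (2 * t)| * (1 + T) +
    1 / (2 * t) * |s ^ 2 - t ^ 2| with hd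
  have hd0 : ∀ s, 0 ≤ d s := fun s => by positivity
  have hlim : Tendsto (fun s => 2 * (d s * C * m) * Real.exp (2 * ∫ t in Ioi 0, w t)) (𝓝 t)
      (𝓝 0) := by
    have hcont : ContinuousAt (fun s => 2 * (d s * C * m) * Real.exp (2 * ∫ t in Ioi 0, w t)) t := by
      simp only [hd]
      have : (2 : ℝ) * t ≠ 0 := by positivity
      fun_prop (disch := assumption)
    have h := hcont.tendsto
    simpa [hd] using h
  filter_upwards [hlim.eventually_lt_const hδ, Ioo_mem_nhds (half_lt_self ht)
    (by linarith : t < 2 * t)] with s hs hst x hx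
  have hs0 : 0 < s := by linarith [hst.1]
  have hsT : s ^ 2 ≤ T := by
    rw [hT]
    exact pow_le_pow_left₀ hs0.le hst.2.le 2
  obtain ⟨M, hM0, hM⟩ := exists_abs_jostProfile_le (α := α) (a := a) hq hs0
  refine (le_exp_of_le_add_integral_Ioi (M := M + C)
    (g := fun x => |jostProfile q α a s x - jostProfile q α a t x|) (c := d s * C * m) hw
    (fun x _ => hw0 x) (fun _ _ => abs_nonneg _) (fun x hx => ?_)
    (by have := hd0 s; positivity) (fun x hx => ?_) hx).trans hs.le
  · exact (abs_sub _ _).trans (add_le_add (hM x hx) (hC x hx))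
  · have hks : ∀ r, x < r → |realKernel s (r - x)| ≤ 1 / t := fun r hr => by
      rw [abs_of_nonneg (realKernel_nonneg hs0 (by linarith))]
      refine (realKernel_le hs0 _).trans ?_
      gcongr
      linarith [hst.1]
    have hi1 := integrableOn_volterra (α := α) (a := a) hq hs0 hs0 hx
    have hi2 := integrableOn_volterra (α := α) (a := a) hq hs0 ht hx
    have hi3 := integrableOn_volterra (α := α) (a := a) hq ht ht hx
    -- The first integral contains the unknown difference and is absorbed by Gronwall; the second
    -- acts on the fixed profile at t and is the small forcing term.
    have e : jostProfile q α a s x - jostProfile q α a t x =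
        (∫ r in Ioi x, realKernel s (r - x) * (realPert q α a s r *
          (jostProfile q α a s r - jostProfile q α a t r))) +
        ∫ r in Ioi x, (realKernel s (r - x) * realPert q α a s r -
          realKernel t (r - x) * realPert q α a t r) * jostProfile q α a t r := by
      rw [jostProfile_volterra hq hs0 hx, jostProfile_volterra hq ht hx, ← integral_add]
      · rw [add_sub_add_left_eq_sub, ← integral_sub hi1 hi3]
        congr 1
        funext r
        ring
      · refine (hi1.sub hi2).congr (Eventually.of_forall fun r => ?_)
        simp only [Pi.sub_apply]
        ring
      · refine (hi2.sub hi3).congr (Eventually.of_forall fun r => ?_)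
        simp only [Pi.sub_apply]
        ring
    have b1 : |∫ r in Ioi x, realKernel s (r - x) * (realPert q α a s r *
          (jostProfile q α a s r - jostProfile q α a t r))| ≤
        ∫ r in Ioi x, w r * |jostProfile q α a s r - jostProfile q α a t r| := by
      rw [← Real.norm_eq_abs]
      refine norm_integral_le_of_norm_le ?_ ?_
      · refine Integrable.mul_bdd (c := M + C) (hw.mono_set (Ioi_subset_Ioi hx))
          ((((continuousOn_jostProfile hq hs0).sub (continuousOn_jostProfile hq ht)).abs.mono
            (Ioi_subset_Ici hx)).aestronglyMeasurable measurableSet_Ioi) ?_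
        filter_upwards [ae_restrict_mem measurableSet_Ioi] with r hr
        have hr0 : 0 ≤ r := hx.trans (le_of_lt hr)
        rw [Real.norm_eq_abs, abs_abs]
        exact (abs_sub _ _).trans (add_le_add (hM r hr0) (hC r hr0))
      · filter_upwards [ae_restrict_mem measurableSet_Ioi] with r hr
        rw [Real.norm_eq_abs, abs_mul, abs_mul, ← mul_assoc]
        refine mul_le_mul_of_nonneg_right ?_ (abs_nonneg _)
        rw [hwdef]
        simp only
        rw [mul_assoc]
        exact mul_le_mul (hks r hr) (abs_realPert_le hsT r) (abs_nonneg _) (by positivity)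
    have b2 : |∫ r in Ioi x, (realKernel s (r - x) * realPert q α a s r -
          realKernel t (r - x) * realPert q α a t r) * jostProfile q α a t r| ≤
        ∫ r in Ioi x, d s * C * majorant q α a r := by
      rw [← Real.norm_eq_abs]
      refine norm_integral_le_of_norm_le ((hmi.mono_set (Ioi_subset_Ioi hx)).const_mul _) ?_
      filter_upwards [ae_restrict_mem measurableSet_Ioi] with r hr
      have hr' : 0 ≤ r - x := sub_nonneg.2 (le_of_lt hr)
      have c1 : |realKernel s (r - x) * realPert q α a s r -
          realKernel t (r - x) * realPert q α a t r| ≤ d s * majorant q α a r := by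
        have c2 : realKernel s (r - x) * realPert q α a s r -
            realKernel t (r - x) * realPert q α a t r =
            (realKernel s (r - x) - realKernel t (r - x)) * realPert q α a s r +
            realKernel t (r - x) * (-(s ^ 2 - t ^ 2) * (1 - rho α a r)) := by
          simp only [realPert]
          ring
        have c3 : |1 - rho α a r| ≤ majorant q α a r :=
          le_add_of_nonneg_left (abs_nonneg _)
        rw [c2]
        refine (abs_add_le _ _).trans ?_
        rw [abs_mul, abs_mul, abs_mul, abs_neg, abs_of_nonneg (realKernel_nonneg ht hr')]
        have c4 := mul_le_mul (abs_realKernel_sub_le hs0 ht hr')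
          (abs_realPert_le (q := q) (α := α) (a := a) hsT r) (abs_nonneg _) (abs_nonneg _)
        have c5 := mul_le_mul (realKernel_le ht (r - x))
          (mul_le_mul_of_nonneg_left c3 (abs_nonneg (s ^ 2 - t ^ 2))) (by positivity)
          (by positivity)
        refine (add_le_add c4 c5).trans (le_of_eq ?_)
        simp only [hd]
        ring
      rw [Real.norm_eq_abs, abs_mul]
      calc _ ≤ d s * majorant q α a r * C := by
            refine mul_le_mul c1 (hC r (hx.trans (le_of_lt hr))) (abs_nonneg _) ?_
            exact mul_nonneg (hd0 s) (majorant_nonneg q α a r)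
        _ = d s * C * majorant q α a r := by ring
    rw [integral_const_mul] at b2
    have b3 : ∫ r in Ioi x, majorant q α a r ≤ m :=
      setIntegral_mono_set hmi (Eventually.of_forall fun r => majorant_nonneg q α a r)
        (Ioi_subset_Ioi hx).eventuallyLE
    have b4 := mul_le_mul_of_nonneg_left b3 (mul_nonneg (hd0 s) hC0)
    rw [e]
    refine (abs_add_le _ _).trans ?_
    linarith

/-- Perturbation of the diagonal: near t₀ the profiles are uniformly close to the one at t₀, whose
square has a positive weighted integral. Since t₀ < s + t < 3t₀, the main term is bounded below with
e^{-3t₀x} and the error above with e^{-t₀x}. -/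
theorem overlap_pos_near (hq : IntegrableOn (fun x : ℝ => (1 + x) * q x) (Ici 0)) (hα : 0 < α)
    {t₀ : ℝ} (ht₀ : 0 < t₀) :
    ∃ U ∈ 𝓝 t₀, ∀ s ∈ U, ∀ t ∈ U, 0 < overlap q α a s t := by
  obtain ⟨C, hC0, hC⟩ := exists_abs_jostProfile_le (α := α) (a := a) hq ht₀
  set N := ∫ x in Ioi 0, rho α a x * jostProfile q α a t₀ x ^ 2 * Real.exp (-(3 * t₀) * x) with hNdef
  have hexp3 : IntegrableOn (fun x : ℝ => Real.exp (-(3 * t₀) * x)) (Ioi 0) :=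
    exp_neg_integrableOn_Ioi 0 (by linarith)
  have hexp1 : IntegrableOn (fun x : ℝ => Real.exp (-t₀ * x)) (Ioi 0) :=
    exp_neg_integrableOn_Ioi 0 ht₀
  have hNi : IntegrableOn (fun x => rho α a x * jostProfile q α a t₀ x ^ 2 *
      Real.exp (-(3 * t₀) * x)) (Ioi 0) := by
    refine Integrable.bdd_mul (c := (α ^ 2 + 1) * C ^ 2) hexp3 ?_ ?_
    · exact (measurable_rho α a).aestronglyMeasurable.mul
        ((((continuousOn_jostProfile hq ht₀).pow 2).mono
          Ioi_subset_Ici_self).aestronglyMeasurable measurableSet_Ioi)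
    · filter_upwards [ae_restrict_mem measurableSet_Ioi] with x hx
      rw [norm_mul, norm_pow, Real.norm_eq_abs, Real.norm_eq_abs]
      have := hC x (le_of_lt hx)
      have := abs_rho_le α a x
      gcongr
  have hN : 0 < N := by
    obtain ⟨X, hX⟩ := eventually_atTop.1 ((tendsto_jostProfile (α := α) (a := a) hq ht₀).eventually_ne
      one_ne_zero)
    refine setIntegral_Ioi_pos (X := X) hNi (fun x _ => ?_) fun x hx => ?_
    · have := rho_pos hα a x
      positivity
    · have := rho_pos hα a x
      have := hX x hx.le
      positivity
  -- If both profiles are within δ ≤ 1 of f and |f| ≤ C, their product is at least f² - (2C + 1)δ.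
  -- The integrated error is cδ/t₀, which δ keeps below N.
  set c := (α ^ 2 + 1) * (2 * C + 1) with hc
  have hc0 : 0 < c := by positivity
  set δ := min 1 (N * t₀ / (2 * c)) with hδ
  have hδ0 : 0 < δ := by positivity
  have hδ1 : δ ≤ 1 := min_le_left _ _
  have hδ2 : c * δ / t₀ < N := by
    have : δ ≤ N * t₀ / (2 * c) := min_le_right _ _
    rw [le_div_iff₀ (by positivity)] at this
    rw [div_lt_iff₀ ht₀]
    nlinarith [mul_pos hN ht₀]
  refine ⟨_, inter_mem (eventually_abs_jostProfile_sub_le (α := α) (a := a) hq ht₀ hδ0)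
    (Ioo_mem_nhds (by linarith : t₀ / 2 < t₀) (by linarith : t₀ < 3 * t₀ / 2)), ?_⟩
  rintro s ⟨hs, hs'⟩ t ⟨ht, ht'⟩
  simp only [mem_ofPred_eq] at hs ht
  have hs0 : 0 < s := by linarith [hs'.1]
  have ht0 : 0 < t := by linarith [ht'.1]
  have hle : ∫ x in Ioi 0, (rho α a x * jostProfile q α a t₀ x ^ 2 * Real.exp (-(3 * t₀) * x) -
      c * δ * Real.exp (-t₀ * x)) ≤ overlap q α a s t := by
    refine setIntegral_mono_on (hNi.sub (hexp1.const_mul _)) (integrableOn_overlap hq hs0 ht0)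
      measurableSet_Ioi fun x hx => ?_
    have hx0 : (0 : ℝ) < x := hx
    rw [overlap_integrand]
    have e1 := abs_le.1 (hC x hx0.le)
    have e2 := abs_le.1 (hs x hx0.le)
    have e3 := abs_le.1 (ht x hx0.le)
    set f := jostProfile q α a t₀ x
    set u := jostProfile q α a s x - f with hu
    set v := jostProfile q α a t x - f with hv
    have e4 : f ^ 2 - (2 * C + 1) * δ ≤ jostProfile q α a s x * jostProfile q α a t x := by
      have : jostProfile q α a s x * jostProfile q α a t x = (f + u) * (f + v) := by
        rw [hu, hv]
        ring
      rw [this]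
      have k1 : |f * u| ≤ C * δ := by
        rw [abs_mul]
        exact mul_le_mul (hC x hx0.le) (hs x hx0.le) (abs_nonneg _) hC0
      have k2 : |f * v| ≤ C * δ := by
        rw [abs_mul]
        exact mul_le_mul (hC x hx0.le) (ht x hx0.le) (abs_nonneg _) hC0
      have k3 : |u * v| ≤ δ * 1 := by
        rw [abs_mul]
        exact mul_le_mul (hs x hx0.le) ((ht x hx0.le).trans hδ1) (abs_nonneg _) hδ0.le
      have := (abs_le.1 k1).1
      have := (abs_le.1 k2).1
      have := (abs_le.1 k3).1
      nlinarith
    have hρ := rho_pos hα a x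
    have hρ' := rho_le α a x
    have e5 : Real.exp (-(3 * t₀) * x) ≤ Real.exp (-(s + t) * x) := by
      gcongr
      linarith [hs'.2, ht'.2]
    have e6 : Real.exp (-(s + t) * x) ≤ Real.exp (-t₀ * x) := by
      gcongr
      linarith [hs'.1, ht'.1]
    have p1 := Real.exp_pos (-(s + t) * x)
    calc rho α a x * f ^ 2 * Real.exp (-(3 * t₀) * x) - c * δ * Real.exp (-t₀ * x)
        ≤ rho α a x * f ^ 2 * Real.exp (-(s + t) * x) -
          rho α a x * ((2 * C + 1) * δ) * Real.exp (-(s + t) * x) := by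
          have g1 := mul_le_mul_of_nonneg_left e5 (by positivity : 0 ≤ rho α a x * f ^ 2)
          have g2 : rho α a x * ((2 * C + 1) * δ) * Real.exp (-(s + t) * x) ≤
              (α ^ 2 + 1) * ((2 * C + 1) * δ) * Real.exp (-t₀ * x) := by gcongr
          have g3 : (α ^ 2 + 1) * ((2 * C + 1) * δ) = c * δ := by rw [hc]; ring
          rw [g3] at g2
          linarith
      _ = rho α a x * (f ^ 2 - (2 * C + 1) * δ) * Real.exp (-(s + t) * x) := by ring
      _ ≤ _ := by gcongr
  rw [integral_sub hNi (hexp1.const_mul _), integral_const_mul,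
    integral_exp_mul_Ioi (by linarith) 0] at hle
  simp only [mul_zero, Real.exp_zero, neg_div_neg_eq] at hle
  rw [mul_one_div] at hle
  linarith

/-! ### Positivity for large spectral parameter -/

/-- Far up the imaginary axis the Jost solutions have no zeros on `[0, ∞)`. -/
theorem realJost_ne_zero (hq : IntegrableOn (fun x : ℝ => (1 + x) * q x) (Ici 0)) {t : ℝ}
    (ht : 0 < t) (hT : (∫ x in Ioi 0, |q x|) ^ 2 + 1 ≤ t ^ 2 * min (α ^ 2) 1) {x₀ : ℝ}
    (hx₀ : 0 ≤ x₀) : realJost q α a t x₀ ≠ 0 := by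
  intro hzero
  have hqi : IntegrableOn q (Ioi 0) := integrableOn_of_one_add_mul (integrableOn_Ioi_of_Ici hq)
  have hy := isJostSolution_realJost (α := α) (a := a) hq ht
  have pv := hy.toIsSolution.isPrimitive hq
  have pv' := hy.toIsSolution.isPrimitive_halfDeriv hq
  have pQ := IsPrimitive.tail (g := fun x => (q x : ℂ)) hqi.ofReal
  -- Let G = v v' + Q v² with Q' = -q. The tail Q removes q from G', which needs only the L¹ norm of
  -- q. If v(x₀) = 0 then G(x₀) = 0, while G increases and tends to 0: a contradiction once it grows
  -- strictly.
  have pG := (pv.mul pv').add (pQ.mul (pv.mul pv))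
  set Q : ℝ → ℝ := fun x => ∫ s in Ioi x, q s with hQ
  set v := realJost q α a t
  set d := realJostDeriv q α a t
  have hQc : ∀ x, ∫ s in Ioi x, (q s : ℂ) = (Q x : ℂ) := fun x => integral_complex_ofReal
  have hQb : ∀ x, 0 ≤ x → |Q x| ≤ ∫ x in Ioi 0, |q x| := fun x hx => by
    rw [← Real.norm_eq_abs]
    refine (norm_integral_le_integral_norm _).trans ?_
    exact setIntegral_mono_set hqi.abs (Eventually.of_forall fun _ => abs_nonneg _)
      (Ioi_subset_Ioi hx).eventuallyLE
  have pG' := pG.congr_deriv (h := fun x => ((d x ^ 2 + t ^ 2 * rho α a x * v x ^ 2 +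
      2 * Q x * v x * d x : ℝ) : ℂ)) fun x hx => by
    rw [halfDeriv_realJost hq ht hx, hQc]
    push_cast
    linear_combination -(t ^ 2 * rho α a x * v x ^ 2 : ℂ) * Complex.I_sq
  -- Completing the square gives (v' + Qv)² + (t²ρ - Q²)v², and t²ρ - Q² ≥ 1 by `hT`.
  have hpt : ∀ x, 0 ≤ x → v x ^ 2 ≤ d x ^ 2 + t ^ 2 * rho α a x * v x ^ 2 +
      2 * Q x * v x * d x := fun x hx => by
    have h1 : Q x ^ 2 ≤ (∫ x in Ioi 0, |q x|) ^ 2 := by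
      rw [← sq_abs]
      exact pow_le_pow_left₀ (abs_nonneg _) (hQb x hx) 2
    have h2 := mul_le_mul_of_nonneg_left (min_le_rho α a x) (sq_nonneg t)
    nlinarith [sq_nonneg (d x + Q x * v x), mul_nonneg (sq_nonneg (v x))
      (by linarith : 0 ≤ t ^ 2 * rho α a x - Q x ^ 2 - 1)]
  have hlim : Tendsto (fun x => ((v x : ℂ) * halfDeriv (fun x => (v x : ℂ)) x +
      (∫ s in Ioi x, (q s : ℂ)) * ((v x : ℂ) * (v x : ℂ))).re) atTop (𝓝 0) := by
    have h0 := tendsto_exp_mul_atTop (I_mul_im_pos ht)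
    have hQ0 : Tendsto (fun x => ∫ s in Ioi x, (q s : ℂ)) atTop (𝓝 0) :=
      tendsto_integral_Ioi_zero tendsto_id
    have h1 := ((hy.tendsto_val.mul hy.tendsto_deriv).add
      (hQ0.mul (hy.tendsto_val.mul hy.tendsto_val))).mul (h0.mul h0)
    rw [mul_zero, mul_zero] at h1
    have h2 := (Complex.continuous_re.tendsto _).comp h1
    rw [Complex.zero_re] at h2
    refine h2.congr fun x => ?_
    have e : Complex.exp (-(Complex.I * (Complex.I * t) * x)) *
        Complex.exp (Complex.I * (Complex.I * t) * x) = 1 := by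
      rw [← Complex.exp_add]
      simp
    simp only [Function.comp_apply]
    congr 1
    linear_combination ((v x : ℂ) * halfDeriv (fun x => (v x : ℂ)) x +
      (∫ s in Ioi x, (q s : ℂ)) * ((v x : ℂ) * (v x : ℂ))) *
      (Complex.exp (-(Complex.I * (Complex.I * t) * x)) *
        Complex.exp (Complex.I * (Complex.I * t) * x) + 1) * e
  obtain ⟨X, hX⟩ := eventually_atTop.1
    ((tendsto_jostProfile (α := α) (a := a) hq ht).eventually_ne one_ne_zero)
  set y := max X (x₀ + 1)
  have hxy : x₀ < y := lt_of_lt_of_le (lt_add_one x₀) (le_max_right _ _)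
  have hvy : v y ≠ 0 := fun h => hX y (le_max_left _ _) (by
    rw [jostProfile]
    change v y * _ = 0
    rw [h, zero_mul])
  have h1 := pG'.re hx₀ hxy.le
  simp only [Complex.ofReal_re] at h1
  have h2 : 0 < ∫ x in x₀..y, v x ^ 2 := by
    refine intervalIntegral.integral_pos hxy
      (((continuousOn_realJost hq ht).pow 2).mono fun x hx => hx₀.trans hx.1)
      (fun x _ => sq_nonneg _) ⟨y, right_mem_Icc.2 hxy.le, by positivity⟩
  have hri : ∀ z, 0 ≤ z → IntervalIntegrable (fun x => d x ^ 2 + t ^ 2 * rho α a x * v x ^ 2 +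
      2 * Q x * v x * d x) volume 0 z := fun z hz => by
    have h := pG'.intervalIntegrable z hz
    have h' := And.intro h.1.re h.2.re
    exact h'
  have h3 : ∫ x in x₀..y, v x ^ 2 ≤ ∫ x in x₀..y, (d x ^ 2 + t ^ 2 * rho α a x * v x ^ 2 +
      2 * Q x * v x * d x) := by
    refine intervalIntegral.integral_mono_on hxy.le ?_
      ((hri x₀ hx₀).symm.trans (hri y (hx₀.trans hxy.le))) fun x hx => hpt x (hx₀.trans hx.1)
    refine ContinuousOn.intervalIntegrable ?_
    rw [uIcc_of_le hxy.le]
    exact ((continuousOn_realJost hq ht).pow 2).mono fun x hx => hx₀.trans hx.1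
  have h4 : ((v y : ℂ) * halfDeriv (fun x => (v x : ℂ)) y +
      (∫ s in Ioi y, (q s : ℂ)) * ((v y : ℂ) * (v y : ℂ))).re ≤ 0 := by
    refine ge_of_tendsto hlim ?_
    filter_upwards [eventually_ge_atTop y] with z hz
    rw [pG'.re (hx₀.trans hxy.le) hz]
    refine le_add_of_nonneg_right (intervalIntegral.integral_nonneg hz fun x hx => ?_)
    rw [Complex.ofReal_re]
    exact (sq_nonneg _).trans (hpt x (hx₀.trans (hxy.le.trans hx.1)))
  rw [h1, hzero] at h4
  simp only [Complex.ofReal_zero, zero_mul, mul_zero, add_zero, Complex.zero_re, zero_add] at h4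
  linarith

theorem realJost_pos (hq : IntegrableOn (fun x : ℝ => (1 + x) * q x) (Ici 0)) {t : ℝ}
    (ht : 0 < t) (hT : (∫ x in Ioi 0, |q x|) ^ 2 + 1 ≤ t ^ 2 * min (α ^ 2) 1) {x : ℝ}
    (hx : 0 ≤ x) : 0 < realJost q α a t x := by
  by_contra hneg
  obtain ⟨X, hX⟩ := eventually_atTop.1
    ((tendsto_jostProfile (α := α) (a := a) hq ht).eventually_const_lt zero_lt_one)
  have hpos : 0 < realJost q α a t (max X x) := by
    rw [realJost_eq]
    exact mul_pos (hX _ (le_max_left _ _)) (Real.exp_pos _)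
  obtain ⟨z, hz, hz0⟩ := intermediate_value_Icc (le_max_right X x)
    ((continuousOn_realJost (α := α) (a := a) hq ht).mono fun z hz => hx.trans hz.1)
    ⟨not_lt.1 hneg, hpos.le⟩
  exact realJost_ne_zero hq ht hT (hx.trans hz.1) hz0

theorem overlap_pos_of_large (hq : IntegrableOn (fun x : ℝ => (1 + x) * q x) (Ici 0))
    (hα : 0 < α) :
    ∃ T : ℝ, 0 < T ∧ ∀ s t, T ≤ s → T ≤ t → 0 < overlap q α a s t := by
  set K := (∫ x in Ioi 0, |q x|) ^ 2 + 1
  have hK : 0 < K := by positivity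
  have hmin : 0 < min (α ^ 2) 1 := by positivity
  -- For t ≥ 1 one has t² ≥ t, so a linear lower bound on t is enough.
  have key : ∀ t, max 1 (K / min (α ^ 2) 1) ≤ t → K ≤ t ^ 2 * min (α ^ 2) 1 := fun t ht => by
    have h1 := (le_max_left _ _).trans ht
    have h2 := (le_max_right _ _).trans ht
    rw [div_le_iff₀ hmin] at h2
    nlinarith
  refine ⟨max 1 (K / min (α ^ 2) 1), by positivity, fun s t hs ht => ?_⟩
  have hs0 : 0 < s := zero_lt_one.trans_le ((le_max_left _ _).trans hs)
  have ht0 : 0 < t := zero_lt_one.trans_le ((le_max_left _ _).trans ht)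
  have hpos : ∀ x, 0 < x → 0 < rho α a x * (realJost q α a s x * realJost q α a t x) :=
    fun x hx => mul_pos (rho_pos hα a x) (mul_pos (realJost_pos hq hs0 (key s hs) hx.le)
      (realJost_pos hq ht0 (key t ht) hx.le))
  exact setIntegral_Ioi_pos (X := 0) (integrableOn_overlap hq hs0 ht0)
    (fun x hx => (hpos x hx).le) hpos

/-! ### Counting the zeros on the imaginary axis -/

/-- The boundary coefficient at `it`. -/
def realCoeff (c : Fin 3 → ℝ) (t : ℝ) : ℝ := c 0 - c 1 * t - c 2 * t ^ 2

theorem bdryCoeff_I_mul (c : Fin 3 → ℝ) (t : ℝ) :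
    bdryCoeff c (Complex.I * t) = (realCoeff c t : ℂ) := by
  rw [bdryCoeff, realCoeff]
  push_cast
  linear_combination ((c 1 : ℂ) * t + (c 2 : ℂ) * t ^ 2) * Complex.I_sq

/-- Counterpart on the axis of `bdryCoeff_mul_conj_im`: for s, t > 0 the sign conditions make the
bracket nonnegative. -/
theorem realCoeff_mul_sub (A B : Fin 3 → ℝ) (s t : ℝ) :
    realCoeff A s * realCoeff B t - realCoeff A t * realCoeff B s =
      (t - s) * (-(A 0 * B 1 - A 1 * B 0) - (s + t) * (A 0 * B 2 - A 2 * B 0) +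
        s * t * (A 1 * B 2 - A 2 * B 1)) := by
  simp only [realCoeff]
  ring

theorem finite_realCoeff_eq_zero {c : Fin 3 → ℝ} (hc : c ≠ 0) :
    {t : ℝ | realCoeff c t = 0}.Finite := by
  set p : Polynomial ℝ := Polynomial.C (c 0) - Polynomial.C (c 1) * Polynomial.X -
    Polynomial.C (c 2) * Polynomial.X ^ 2 with hp
  have hp0 : p ≠ 0 := by
    intro h
    refine hc (funext fun i => ?_)
    have h0 := congrArg (fun r => Polynomial.coeff r 0) h
    have h1 := congrArg (fun r => Polynomial.coeff r 1) h
    have h2 := congrArg (fun r => Polynomial.coeff r 2) h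
    simp [hp, Polynomial.coeff_X, Polynomial.coeff_C, Polynomial.coeff_X_pow] at h0 h1 h2
    fin_cases i <;> simp [h0, h1, h2]
  refine (Polynomial.finite_setOfPred_isRoot hp0).subset fun t ht => ?_
  simpa [Polynomial.IsRoot, hp, realCoeff] using ht

/-- At most two points are possible, since two of any three nonzero reals have the same sign. -/
theorem finite_of_pairwise_mul_neg {S : Set ℝ} {φ : ℝ → ℝ}
    (h : ∀ s ∈ S, ∀ t ∈ S, s ≠ t → φ s * φ t < 0) : S.Finite := by
  by_contra hinf
  obtain ⟨F, hFS, hF⟩ := Set.Infinite.exists_subset_card_eq hinf 3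
  obtain ⟨x, y, z, hxy, hxz, hyz, rfl⟩ := Finset.card_eq_three.1 hF
  have hx : x ∈ S := hFS (by simp)
  have hy : y ∈ S := hFS (by simp)
  have hz : z ∈ S := hFS (by simp)
  have h1 := h x hx y hy hxy
  have h2 := h x hx z hz hxz
  have h3 := h y hy z hz hyz
  have h4 := mul_pos_of_neg_of_neg h1 h2
  nlinarith [sq_nonneg (φ x)]

section Counting

variable {A B : Fin 3 → ℝ}

theorem realCoeff_mul_add_eq_zero {t : ℝ}
    (ht : charFun q α a A B (Complex.I * t) = 0) :
    realCoeff B t * realJostDeriv q α a t 0 + realCoeff A t * realJost q α a t 0 = 0 := by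
  have h := congrArg Complex.re ht
  rw [charFun, bdryCoeff_I_mul, bdryCoeff_I_mul, Complex.add_re, Complex.re_ofReal_mul,
    Complex.re_ofReal_mul, Complex.zero_re] at h
  exact h

/-- Multiplied by B(is)B(it), the Wronskian loses its derivatives through the boundary conditions
and becomes -(A(is)B(it) - A(it)B(is)) v_s(0)v_t(0). It is positive for s < t, and the bracket is
nonnegative. -/
theorem realJost_mul_neg_of_zeros (hq : IntegrableOn (fun x : ℝ => (1 + x) * q x) (Ici 0))
    (hδ₁ : A 0 * B 1 - A 1 * B 0 ≤ 0)
    (hδ₂ : A 0 * B 2 - A 2 * B 0 ≤ 0)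
    (hδ₃ : 0 ≤ A 1 * B 2 - A 2 * B 1) {s t : ℝ} (hs : 0 < s) (ht : 0 < t) (hst : s ≠ t)
    (hEs : charFun q α a A B (Complex.I * s) = 0) (hEt : charFun q α a A B (Complex.I * t) = 0)
    (hov : 0 < overlap q α a s t) (hB : 0 < realCoeff B s * realCoeff B t) :
    realJost q α a s 0 * realJost q α a t 0 < 0 := by
  wlog hlt : s < t generalizing s t
  · rw [mul_comm]
    exact this ht hs hst.symm hEt hEs (by rwa [overlap_comm]) (by rwa [mul_comm])
      (lt_of_le_of_ne (not_lt.1 hlt) hst.symm)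
  have hW := wronskian_realJost (α := α) (a := a) hq hs ht
  have es := realCoeff_mul_add_eq_zero hEs
  have et := realCoeff_mul_add_eq_zero hEt
  have hWpos : 0 < (t ^ 2 - s ^ 2) * overlap q α a s t :=
    mul_pos (by nlinarith) hov
  rw [← hW] at hWpos
  have hid : realCoeff B s * realCoeff B t * (realJostDeriv q α a s 0 * realJost q α a t 0 -
      realJost q α a s 0 * realJostDeriv q α a t 0) =
      -((realCoeff A s * realCoeff B t - realCoeff A t * realCoeff B s) *
        (realJost q α a s 0 * realJost q α a t 0)) := by
    linear_combination realCoeff B t * realJost q α a t 0 * es -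
      realCoeff B s * realJost q α a s 0 * et
  have hnn : 0 ≤ realCoeff A s * realCoeff B t - realCoeff A t * realCoeff B s := by
    rw [realCoeff_mul_sub]
    refine mul_nonneg (by linarith) ?_
    have e1 := mul_nonneg (add_pos hs ht).le (neg_nonneg.2 hδ₂)
    have e2 := mul_nonneg (mul_pos hs ht).le hδ₃
    linarith
  have hpos := mul_pos hB hWpos
  rw [hid] at hpos
  by_contra hcon
  have := mul_nonneg hnn (not_lt.1 hcon)
  linarith

/-- There are finitely many zeros in any set on which the Jost solutions have positive inner
products. -/
theorem finite_zeros_of_overlap_pos (hq : IntegrableOn (fun x : ℝ => (1 + x) * q x) (Ici 0))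
    (hδ₁ : A 0 * B 1 - A 1 * B 0 ≤ 0)
    (hδ₂ : A 0 * B 2 - A 2 * B 0 ≤ 0)
    (hδ₃ : 0 ≤ A 1 * B 2 - A 2 * B 1) (hAB : A ≠ 0 ∨ B ≠ 0) {U : Set ℝ}
    (hU : ∀ s ∈ U, ∀ t ∈ U, 0 < s → 0 < t → 0 < overlap q α a s t) :
    ({t : ℝ | 0 < t ∧ charFun q α a A B (Complex.I * t) = 0} ∩ U).Finite := by
  set S := {t : ℝ | 0 < t ∧ charFun q α a A B (Complex.I * t) = 0} ∩ U
  have hpos : (S ∩ {t | 0 < realCoeff B t}).Finite :=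
    finite_of_pairwise_mul_neg (φ := fun t => realJost q α a t 0) fun s hs t ht hst =>
      realJost_mul_neg_of_zeros hq hδ₁ hδ₂ hδ₃ hs.1.1.1 ht.1.1.1 hst hs.1.1.2 ht.1.1.2
        (hU s hs.1.2 t ht.1.2 hs.1.1.1 ht.1.1.1) (mul_pos hs.2 ht.2)
  have hneg : (S ∩ {t | realCoeff B t < 0}).Finite :=
    finite_of_pairwise_mul_neg (φ := fun t => realJost q α a t 0) fun s hs t ht hst =>
      realJost_mul_neg_of_zeros hq hδ₁ hδ₂ hδ₃ hs.1.1.1 ht.1.1.1 hst hs.1.1.2 ht.1.1.2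
        (hU s hs.1.2 t ht.1.2 hs.1.1.1 ht.1.1.1) (mul_pos_of_neg_of_neg hs.2 ht.2)
  -- If B is not identically zero, it has finitely many roots. Otherwise a zero is a root of A or
  -- satisfies v_t(0) = 0, and the Wronskian identity excludes two parameters of the latter kind.
  have hzero : (S ∩ {t | realCoeff B t = 0}).Finite := by
    by_cases hB : B = 0
    · have hA : A ≠ 0 := hAB.resolve_right (not_not.2 hB)
      have hB0 : ∀ t, realCoeff B t = 0 := fun t => by simp [realCoeff, hB]
      have hsub : (S ∩ {t | realCoeff A t ≠ 0}).Subsingleton := by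
        intro s hs t ht
        by_contra hst
        have h0 : ∀ r ∈ S ∩ {t | realCoeff A t ≠ 0}, realJost q α a r 0 = 0 := fun r hr => by
          have h := realCoeff_mul_add_eq_zero hr.1.1.2
          rw [hB0, zero_mul, zero_add] at h
          exact (mul_eq_zero.1 h).resolve_left hr.2
        have hW := wronskian_realJost (α := α) (a := a) hq hs.1.1.1 ht.1.1.1
        rw [h0 s hs, h0 t ht, mul_zero, zero_mul, sub_zero] at hW
        have hov := hU s hs.1.2 t ht.1.2 hs.1.1.1 ht.1.1.1
        have h2 := (mul_eq_zero.1 hW.symm).resolve_right hov.ne'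
        have h3 : t ^ 2 = s ^ 2 := sub_eq_zero.1 h2
        exact hst ((pow_left_inj₀ ht.1.1.1.le hs.1.1.1.le two_ne_zero).1 h3).symm
      refine (hsub.finite.union (finite_realCoeff_eq_zero hA)).subset fun t ht => ?_
      by_cases h : realCoeff A t = 0
      · exact Or.inr h
      · exact Or.inl ⟨ht.1, h⟩
    · exact (finite_realCoeff_eq_zero hB).subset inter_subset_right
  refine ((hpos.union hneg).union hzero).subset fun t ht => ?_
  rcases lt_trichotomy (realCoeff B t) 0 with h | h | h
  · exact Or.inl (Or.inr ⟨ht, h⟩)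
  · exact Or.inr ⟨ht, h⟩
  · exact Or.inl (Or.inl ⟨ht, h⟩)

theorem finite_imaginary_zeros (hq : IntegrableOn (fun x : ℝ => (1 + x) * q x) (Ici 0))
    (hα : 0 < α) (hδ₁ : A 0 * B 1 - A 1 * B 0 ≤ 0)
    (hδ₂ : A 0 * B 2 - A 2 * B 0 ≤ 0)
    (hδ₃ : 0 ≤ A 1 * B 2 - A 2 * B 1) (hAB : A ≠ 0 ∨ B ≠ 0) :
    {t : ℝ | 0 < t ∧ charFun q α a A B (Complex.I * t) = 0}.Finite := by
  obtain ⟨ε, hε, hsmall⟩ := overlap_pos_near_zero (α := α) (a := a) hq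
  obtain ⟨T, hT, hlarge⟩ := overlap_pos_of_large (a := a) hq hα
  set S := {t : ℝ | 0 < t ∧ charFun q α a A B (Complex.I * t) = 0}
  have h1 : (S ∩ Iio ε).Finite := finite_zeros_of_overlap_pos hq hδ₁ hδ₂ hδ₃ hAB
    fun s hs t ht hs0 ht0 => hsmall s t hs0 ht0 hs ht
  have h2 : (S ∩ Ici T).Finite := finite_zeros_of_overlap_pos hq hδ₁ hδ₂ hδ₃ hAB
    fun s hs t ht _ _ => hlarge s t hs ht
  have h3 : (S ∩ Icc ε T).Finite := by
    -- Finiteness passes to subsets and finite unions, so local finiteness at each point of the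
    -- compact interval suffices.
    refine (isCompact_Icc (a := ε) (b := T)).induction_on (p := fun U => (S ∩ U).Finite)
      (by simp) (fun U V hUV hV => hV.subset (inter_subset_inter_right S hUV))
      (fun U V hU hV => by rw [inter_union_distrib_left]; exact hU.union hV) fun t ht => ?_
    obtain ⟨U, hU, hpos⟩ := overlap_pos_near (a := a) hq hα (hε.trans_le ht.1)
    exact ⟨U, mem_nhdsWithin_of_mem_nhds hU, finite_zeros_of_overlap_pos hq hδ₁ hδ₂ hδ₃ hAB
      fun s hs t ht _ _ => hpos s hs t ht⟩
  refine ((h1.union h2).union h3).subset fun t ht => ?_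
  rcases lt_or_ge t ε with h | h
  · exact Or.inl (Or.inl ⟨ht, h⟩)
  · rcases le_or_gt T t with h' | h'
    · exact Or.inl (Or.inr ⟨ht, h'⟩)
    · exact Or.inr ⟨ht, h, h'.le⟩

end Counting

end SturmLiouville

theorem mainTheorem5 (q : ℝ → ℝ) (α a : ℝ) (A B : Fin 3 → ℝ)
    (hq : IntegrableOn (fun x : ℝ => (1 + x) * q x) (Ici 0))
    (hα : 0 < α) (hα1 : α ≠ 1) (ha : 0 < a)
    (hδ₁ : A 0 * B 1 - A 1 * B 0 ≤ 0)
    (hδ₂ : A 0 * B 2 - A 2 * B 0 ≤ 0)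
    (hδ₃ : 0 ≤ A 1 * B 2 - A 2 * B 1)
    (hbdry : ∀ l : ℂ, 0 < l.im → l.re ≠ 0 →
      ¬ (SturmLiouville.bdryCoeff A l = 0 ∧ SturmLiouville.bdryCoeff B l = 0)) :
    {l : ℂ | 0 < l.im ∧ SturmLiouville.charFun q α a A B l = 0}.Finite ∧
      ∀ l : ℂ, 0 < l.im → SturmLiouville.charFun q α a A B l = 0 → l.re = 0 := by
  have hre : ∀ l : ℂ, 0 < l.im → SturmLiouville.charFun q α a A B l = 0 → l.re = 0 :=
    fun l hl hE => SturmLiouville.re_eq_zero_of_charFun_eq_zero hq hα hδ₁ hδ₂ hδ₃ hbdry hl hE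
  refine ⟨?_, hre⟩
  have hAB : A ≠ 0 ∨ B ≠ 0 := by
    by_contra! h
    -- If A = B = 0 the boundary condition is void everywhere; 1 + i is one point off the axis.
    exact hbdry (1 + Complex.I) (by simp) (by simp)
      ⟨by simp [SturmLiouville.bdryCoeff, h.1], by simp [SturmLiouville.bdryCoeff, h.2]⟩
  refine ((SturmLiouville.finite_imaginary_zeros (a := a) hq hα hδ₁ hδ₂ hδ₃ hAB).image
    fun t : ℝ => Complex.I * t).subset fun l hl => ?_
  have hl' : Complex.I * (l.im : ℂ) = l := by
    apply Complex.ext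
    · simp [hre l hl.1 hl.2]
    · simp
  exact ⟨l.im, ⟨hl.1, by rw [hl']; exact hl.2⟩, hl'⟩
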